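/- Let $n\ge 3$ and let $P$ be a closed polygonal curve in $\mathbb{R}^4$ with successive vertices $v_1,\dots,v_n$ (indices modulo $n$) and $n$ edges $[v_i,v_{i+1}]$, which is embedded: each edge is non-degenerate and two distinct edges meet only in a vertex shared as consecutive edges. Then there exist a finite abstract simplicial complex $K$ having exactly $3n$ triangles, whose geometric realization $|K|$ is a PL disk (that is, PL homeomorphic to a convex polygon in the plane with non-empty interior), and a map $f:|K|\to\mathbb{R}^4$ that is affine on every simplex, such that: (1) $f$ is an immersion, i.e. locally injective, and it is complementary: $f$ is injective on the boundary $\partial|K|$ (the union of the edges of $K$ that lie in exactly one triangle), and $f(|K|\setminus\partial|K|)$ is disjoint from $f(\partial|K|)$; (2) the surface is locally flat, sheet by sheet: each $x\in|K|$ has an open neighbourhood $U$ in $|K|$ on which $f$ is a topological embedding, together with a homeomorphism $e$ from an open neighbourhood $W$ of $f(x)$ in $\mathbb{R}^4$ onto an open subset of $\mathbb{R}^4$, with $e(f(U)\cap W)=e(W)\cap(\mathbb{R}^2\times\{0\})$ if $x\notin\partial|K|$, and $e(f(U)\cap W)=e(W)\cap([0,\infty)\times\mathbb{R}\times\{0\})$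 and $e(f(x))\in\{0\}\times\mathbb{R}\times\{0\}$ if $x\in\partial|K|$; (3) $P$ is the PL boundary, with no added vertices: there are distinct vertices $b_1,\dots,b_n$ of $K$ with $f(b_i)=v_i$ such that the edges of $K$ lying in exactly one triangle are precisely $\{b_i,b_{i+1}\}$, $i=1,\dots,n$ (indices modulo $n$). -/

import Mathlib

namespace PLSurface

/-- A closed polygonal curve is embedded when its parametrization by the half-open edges
`[P i, P (i + 1))` is injective: no edge is degenerate, and two edges meet only where consecutive
edges share a vertex. -/
def IsEmbeddedPolygon {E : Type*} [AddCommGroup E] [Module ℝ E] {n : ℕ} (P : Polygon E n) : Prop :=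
  Function.Injective fun q : Fin n × Set.Ico (0 : ℝ) 1 => P.edgePath ℝ q.1 q.2

/-- A compact polyhedron: a finite union of convex hulls of finite sets. -/
def IsPolyhedron {E : Type*} [AddCommGroup E] [Module ℝ E] (S : Set E) : Prop :=
  ∃ F : Finset (Finset E), S = ⋃ s ∈ F, convexHull ℝ (s : Set E)

section Complex

variable {V : Type*} [Fintype V] (K : AbstractSimplicialComplex V)

/-- The geometric realization `|K|`, in barycentric coordinates. -/
def realization : Set (V → ℝ) :=
  {x | x ∈ stdSimplex ℝ V ∧ ∃ s ∈ K.faces, ∀ v, v ∉ s → x v = 0}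

/-- The triangles (two-dimensional faces) of `K`. -/
def triangles : Set (Finset V) :=
  {t | t ∈ K.faces ∧ t.card = 3}

/-- The boundary edges of `K`: the edges that lie in exactly one triangle. -/
def boundaryEdges : Set (Finset V) :=
  {e | e ∈ K.faces ∧ e.card = 2 ∧ ∃! t, t ∈ triangles K ∧ e ⊆ t}

/-- The subset of `|K|` that is covered by the boundary edges of `K`. -/
def boundary : Set (V → ℝ) :=
  {x | x ∈ stdSimplex ℝ V ∧ ∃ e ∈ boundaryEdges K, ∀ v, v ∉ e → x v = 0}

/-- `K` triangulates a PL disk: `|K|` is homeomorphic to a (non-degenerate) convex polygon of the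
plane by a homeomorphism that is piecewise linear, i.e. whose graph is a compact polyhedron. -/
def IsPLDisk : Prop :=
  ∃ C : Finset (EuclideanSpace ℝ (Fin 2)),
    (interior (convexHull ℝ (C : Set (EuclideanSpace ℝ (Fin 2))))).Nonempty ∧
    ∃ h : realization K ≃ₜ convexHull ℝ (C : Set (EuclideanSpace ℝ (Fin 2))),
      IsPolyhedron (Set.range fun x : realization K =>
        ((x : V → ℝ), (h x : EuclideanSpace ℝ (Fin 2))))

section Map

variable {E : Type*} [AddCommGroup E] [Module ℝ E]

/-- The map on `|K|` that sends each vertex `v` to `p v` and is affine on every simplex. -/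
def realize (p : V → E) (x : V → ℝ) : E :=
  ∑ v, x v • p v

/-- The simplexwise affine map with vertex images `p` is a PL immersion of `|K|`:
it is locally injective. -/
def IsImmersed (p : V → E) : Prop :=
  ∀ x ∈ realization K, ∃ U : Set (V → ℝ), IsOpen U ∧ x ∈ U ∧
    Set.InjOn (realize p) (U ∩ realization K)

/-- A complementary immersed surface: it is immersed, its boundary is embedded, and its interior
does not meet its boundary. -/
def IsComplementaryImmersed (p : V → E) : Prop :=
  IsImmersed K p ∧
  Set.InjOn (realize p) (boundary K) ∧
  Disjoint (realize p '' (realization K \ boundary K)) (realize p '' boundary K)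

/-- The surface has the polygon `P` itself (without additional vertices) as its PL boundary: the
boundary of `K` is a cycle of `n` edges whose successive vertices are mapped to the successive
vertices of `P`. -/
def HasPLBoundary (p : V → E) {n : ℕ} (P : Polygon E n) : Prop :=
  ∃ b : Fin n → V, Function.Injective b ∧
    (∀ e : Finset V, e ∈ boundaryEdges K ↔ ∃ i, (e : Set V) = {b i, b (finRotate n i)}) ∧
    ∀ i, p (b i) = P i

end Map

/-- Local flatness in four-space of each sheet of an immersed surface. Around every point `x` of the
surface there is a sheet, the image of a neighbourhood `U` of `x` on which the map is an embedding,
and a chart `e` of four-space around the image of `x`, which together straighten the surface: the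
chart takes the sheet to the coordinate plane `y 2 = y 3 = 0` if `x` is an interior point, and to
the half-plane `y 2 = y 3 = 0`, `0 ≤ y 0`, with the image of `x` on its edge `y 0 = 0`, if `x` is a
boundary point. -/
def IsLocallyFlat (p : V → EuclideanSpace ℝ (Fin 4)) : Prop :=
  ∀ x ∈ realization K, ∃ U : Set (V → ℝ), IsOpen U ∧ x ∈ U ∧
    Topology.IsEmbedding ((U ∩ realization K).domRestrict (realize p)) ∧
    ∃ e : OpenPartialHomeomorph (EuclideanSpace ℝ (Fin 4)) (EuclideanSpace ℝ (Fin 4)),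
      realize p x ∈ e.source ∧
      (x ∉ boundary K → ∀ y ∈ e.source,
        (y ∈ realize p '' (U ∩ realization K) ↔ e y 2 = 0 ∧ e y 3 = 0)) ∧
      (x ∈ boundary K → e (realize p x) 0 = 0 ∧ ∀ y ∈ e.source,
        (y ∈ realize p '' (U ∩ realization K) ↔ e y 2 = 0 ∧ e y 3 = 0 ∧ 0 ≤ e y 0))

end Complex

end PLSurface

/-! The disk is a collared wheel: a cone from a hub over an inner n-cycle (n triangles) and a collar
of 2n triangles between this cycle and the rim. The same combinatorics drawn in the plane, with
concentric regular n-gons of radius 1 and 2, shows that it is a PL disk. In four-space the rim goes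
to P, the hub to a point ζ, and the inner cycle to an affine regular n-gon centred at ζ in the plane
through ζ spanned by A and B.

Everything rests on a generic choice of A, B, ζ (`exists_isGeneric`): each of finitely many
conditions excludes an affine subspace of dimension at most three. Interior double points are
allowed, so only two facts are needed. First, no interior point lands on P
(`IsGeneric.mem_boundary`), because the inner vertices avoid the three-dimensional spaces determined
by P. Second, the surface is locally flat, which also gives local injectivity.

For flatness it suffices to straighten the open star of each vertex, and only boundary points need
the star of a rim vertex. The star of the hub is planar. At an inner vertex the hub lies in the
plane of the two inner edges, so the five rays reduce to four independent ones; the star is then a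
cone over a quadrilateral, that is, a product of two corners (`cornerHomeomorph`). At a rim vertex
the star is a cone over a path of three edges. Embeddedness of P forces its end rays to be
independent or opposite, and in both cases a shear makes the star the graph of a clamp function over
a half-plane (`halfHomeomorph`). -/

namespace PLSurface

/-! ### Combinatorics of the collared wheel -/

section Wheel

variable {n : ℕ} [NeZero n]

/-- The vertices of the collared wheel: `n` vertices on the rim, `n` on an inner cycle, a hub. -/
abbrev Vert (n : ℕ) : Type := Fin n ⊕ Fin n ⊕ Unit

abbrev rim (i : Fin n) : Vert n := Sum.inl i
abbrev mid (i : Fin n) : Vert n := Sum.inr (Sum.inl i)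
abbrev hub : Vert n := Sum.inr (Sum.inr ())

def hubTriangle (i : Fin n) : Finset (Vert n) := {mid i, mid (i + 1), hub}
def rimTriangle (i : Fin n) : Finset (Vert n) := {rim i, rim (i + 1), mid i}
def midTriangle (i : Fin n) : Finset (Vert n) := {rim (i + 1), mid i, mid (i + 1)}

/-- The cone over the inner cycle together with a collar between inner cycle and rim. -/
def wheel (n : ℕ) [NeZero n] : AbstractSimplicialComplex (Vert n) where
  faces := {s | s.Nonempty ∧ ∃ i, s ⊆ hubTriangle i ∨ s ⊆ rimTriangle i ∨ s ⊆ midTriangle i}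
  isRelLowerSet_faces := by
    rintro s ⟨hs, i, hi⟩
    refine ⟨hs, fun t hts ht => ⟨ht, i, ?_⟩⟩
    exact hi.imp hts.trans (Or.imp hts.trans hts.trans)
  singleton_mem v := by
    refine ⟨Finset.singleton_nonempty v, ?_⟩
    rcases v with i | i | u
    · exact ⟨i, by simp [rimTriangle]⟩
    · exact ⟨i, by simp [rimTriangle]⟩
    · exact ⟨0, by simp [hubTriangle]⟩

theorem add_one_ne (hn : 3 ≤ n) (i : Fin n) : i + 1 ≠ i := by
  intro h
  have : (1 : Fin n) = 0 := by simpa using h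
  have := congrArg Fin.val this
  simp [Nat.mod_eq_of_lt (show 1 < n by omega)] at this

theorem add_one_add_one_ne (hn : 3 ≤ n) (i : Fin n) : i + 1 + 1 ≠ i := by
  intro h
  have : (1 + 1 : Fin n) = 0 := by simpa [add_assoc] using h
  have := congrArg Fin.val this
  simp [Fin.val_add, Nat.mod_eq_of_lt (show 2 < n by omega)] at this

theorem card_hubTriangle (hn : 3 ≤ n) (i : Fin n) : (hubTriangle i).card = 3 := by
  have := add_one_ne hn i
  exact Finset.card_eq_three.2 ⟨_, _, _, by simpa using this.symm, by simp, by simp, rfl⟩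

theorem card_rimTriangle (hn : 3 ≤ n) (i : Fin n) : (rimTriangle i).card = 3 := by
  have := add_one_ne hn i
  exact Finset.card_eq_three.2 ⟨_, _, _, by simpa using this.symm, by simp, by simp, rfl⟩

theorem card_midTriangle (hn : 3 ≤ n) (i : Fin n) : (midTriangle i).card = 3 := by
  have := add_one_ne hn i
  exact Finset.card_eq_three.2 ⟨_, _, _, by simp, by simp, by simpa using this.symm, rfl⟩

theorem mem_triangles_wheel (hn : 3 ≤ n) (t : Finset (Vert n)) :
    t ∈ triangles (wheel n) ↔
      ∃ i, t = hubTriangle i ∨ t = rimTriangle i ∨ t = midTriangle i := by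
  constructor
  · rintro ⟨⟨-, i, h⟩, hc⟩
    refine ⟨i, ?_⟩
    rcases h with h | h | h
    · exact .inl (Finset.eq_of_subset_of_card_le h (by rw [card_hubTriangle hn, hc]))
    · exact .inr (.inl (Finset.eq_of_subset_of_card_le h (by rw [card_rimTriangle hn, hc])))
    · exact .inr (.inr (Finset.eq_of_subset_of_card_le h (by rw [card_midTriangle hn, hc])))
  · rintro ⟨i, h⟩
    have hc : t.card = 3 := by
      rcases h with rfl | rfl | rfl
      exacts [card_hubTriangle hn i, card_rimTriangle hn i, card_midTriangle hn i]
    refine ⟨⟨Finset.card_pos.1 (by omega), i, ?_⟩, hc⟩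
    exact h.imp (fun h => h.subset) (Or.imp (fun h => h.subset) (fun h => h.subset))

theorem ncard_triangles_wheel (hn : 3 ≤ n) : (triangles (wheel n)).ncard = 3 * n := by
  let F : Fin n ⊕ Fin n ⊕ Fin n → Finset (Vert n) :=
    Sum.elim hubTriangle (Sum.elim rimTriangle midTriangle)
  have hF : triangles (wheel n) = Set.range F := by
    ext t
    rw [mem_triangles_wheel hn]
    simp only [F, Set.Sum.elim_range, Set.mem_union, Set.mem_range, exists_or, eq_comm]
  -- An edge of the cycle determines its index: otherwise i = j + 1 and j = i + 1, which a cycle of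
  -- length at least three forbids.
  have key : ∀ {i j : Fin n}, (∀ k, k = i ∨ k = i + 1 ↔ k = j ∨ k = j + 1) → i = j := by
    intro i j h
    have h1 := (h i).1 (.inl rfl)
    have h2 := (h j).2 (.inl rfl)
    rcases h1 with h1 | h1
    · exact h1
    · rcases h2 with h2 | h2
      · exact h2.symm
      · exact absurd (by rw [← h2, ← h1]) (add_one_add_one_ne hn i)
  have hinj : Function.Injective F := by
    rintro (i | i | i) (j | j | j) h
    · congr 1
      refine key fun k => ?_
      have := Finset.ext_iff.1 h (mid k)
      simpa [F, hubTriangle] using this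
    · have := Finset.ext_iff.1 h hub
      simp [F, hubTriangle, rimTriangle] at this
    · have := Finset.ext_iff.1 h hub
      simp [F, hubTriangle, midTriangle] at this
    · have := Finset.ext_iff.1 h hub
      simp [F, hubTriangle, rimTriangle] at this
    · congr 2
      have := Finset.ext_iff.1 h (mid i)
      simpa [F, rimTriangle] using this
    · have := Finset.ext_iff.1 h (rim i)
      have h' := Finset.ext_iff.1 h (rim (i + 1))
      simp only [F, rimTriangle, midTriangle, Sum.elim_inr, Sum.elim_inl, Finset.mem_insert,
        Finset.mem_singleton, Sum.inl.injEq, reduceCtorEq, or_false, true_or, or_true,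
        true_iff] at this h'
      exact absurd (h'.trans this.symm) (add_one_ne hn i)
    · have := Finset.ext_iff.1 h hub
      simp [F, hubTriangle, midTriangle] at this
    · have := Finset.ext_iff.1 h (rim j)
      have h' := Finset.ext_iff.1 h (rim (j + 1))
      simp only [F, rimTriangle, midTriangle, Sum.elim_inr, Sum.elim_inl, Finset.mem_insert,
        Finset.mem_singleton, Sum.inl.injEq, reduceCtorEq, or_false, true_or, or_true,
        iff_true] at this h'
      exact absurd (h'.trans this.symm) (add_one_ne hn j)
    · congr 2
      have := Finset.ext_iff.1 h (rim (i + 1))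
      simpa [F, midTriangle] using this
  rw [hF, ← Set.image_univ, Set.ncard_image_of_injective _ hinj, Set.ncard_univ]
  simp only [Nat.card_eq_fintype_card, Fintype.card_sum, Fintype.card_fin]
  omega

/-- Every other edge is shared by two triangles: spokes by consecutive hub triangles, inner edges by
a hub and a mid triangle, edges between rim and inner cycle by a rim and a mid triangle. A rim edge
has only its rim triangle, since a mid triangle has a single rim vertex. -/
theorem mem_boundaryEdges_wheel (hn : 3 ≤ n) (e : Finset (Vert n)) :
    e ∈ boundaryEdges (wheel n) ↔ ∃ i, e = {rim i, rim (i + 1)} := by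
  have ne1 := add_one_ne hn
  have ne2 := add_one_add_one_ne hn
  constructor
  · rintro ⟨⟨-, i, hi⟩, hc, t, ht, huniq⟩
    obtain ⟨a, b, hab, rfl⟩ := Finset.card_eq_two.1 hc
    have two : ∀ t₁ t₂, t₁ ∈ triangles (wheel n) → t₂ ∈ triangles (wheel n) →
        ({a, b} : Finset (Vert n)) ⊆ t₁ → ({a, b} : Finset (Vert n)) ⊆ t₂ → t₁ = t₂ :=
      fun t₁ t₂ h₁ h₂ s₁ s₂ => (huniq t₁ ⟨h₁, s₁⟩).trans (huniq t₂ ⟨h₂, s₂⟩).symm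
    have Hh := fun i : Fin n => (mem_triangles_wheel hn _).2 ⟨i, .inl rfl⟩
    have Hr := fun i : Fin n => (mem_triangles_wheel hn _).2 ⟨i, .inr (.inl rfl)⟩
    have Hm := fun i : Fin n => (mem_triangles_wheel hn _).2 ⟨i, .inr (.inr rfl)⟩
    have hhm : ∀ i j : Fin n, hubTriangle i ≠ midTriangle j := fun i j h => by
      have := Finset.ext_iff.1 h hub
      simp [hubTriangle, midTriangle] at this
    have hrm : ∀ i j : Fin n, rimTriangle i ≠ midTriangle j := fun i j h => by
      have h1 := Finset.ext_iff.1 h (rim i)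
      have h2 := Finset.ext_iff.1 h (rim (i + 1))
      simp [rimTriangle, midTriangle] at h1 h2
      exact ne1 j (h1.symm.trans h2)
    have hhh : ∀ i : Fin n, hubTriangle i ≠ hubTriangle (i + 1) := fun i h => by
      have h1 := Finset.ext_iff.1 h (mid i)
      simp [hubTriangle] at h1
      rcases h1 with h1 | h1
      exacts [ne1 i (by simpa using h1), ne2 i h1.symm]
    have hubmid : ∀ i : Fin n, ¬({a, b} : Finset (Vert n)) ⊆ {mid i, hub} := fun i h =>
      hhh (i - 1) (two _ _ (Hh _) (Hh _) (h.trans (by simp [hubTriangle, Finset.subset_iff]))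
        (h.trans (by simp [hubTriangle, Finset.subset_iff])))
    have midmid : ∀ i : Fin n, ¬({a, b} : Finset (Vert n)) ⊆ {mid i, mid (i + 1)} := fun i h =>
      hhm i i (two _ _ (Hh _) (Hm _) (h.trans (by simp [hubTriangle, Finset.subset_iff]))
        (h.trans (by simp [midTriangle, Finset.subset_iff])))
    have rimmid : ∀ i : Fin n, ¬({a, b} : Finset (Vert n)) ⊆ {rim i, mid i} := fun i h =>
      hrm i (i - 1) (two _ _ (Hr _) (Hm _) (h.trans (by simp [rimTriangle, Finset.subset_iff]))
        (h.trans (by simp [midTriangle, Finset.subset_iff])))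
    have diag : ∀ i : Fin n, ¬({a, b} : Finset (Vert n)) ⊆ {rim (i + 1), mid i} := fun i h =>
      hrm i i (two _ _ (Hr _) (Hm _) (h.trans (by simp [rimTriangle, Finset.subset_iff]))
        (h.trans (by simp [midTriangle, Finset.subset_iff])))
    have e1 := hubmid i
    have e2 := hubmid (i + 1)
    have e3 := midmid i
    have e4 := rimmid i
    have e5 := rimmid (i + 1)
    have e6 := diag i
    simp only [Finset.insert_subset_iff, Finset.singleton_subset_iff, hubTriangle, rimTriangle,
      midTriangle, Finset.mem_insert, Finset.mem_singleton] at hi e1 e2 e3 e4 e5 e6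
    refine ⟨i, ?_⟩
    have : a = rim i ∧ b = rim (i + 1) ∨ a = rim (i + 1) ∧ b = rim i := by
      clear two Hh Hr Hm hhm hrm hhh hubmid midmid rimmid diag huniq ht ne1 ne2
      grind
    rcases this with ⟨rfl, rfl⟩ | ⟨rfl, rfl⟩
    · rfl
    · exact Finset.pair_comm _ _
  · rintro ⟨i, rfl⟩
    have hsub : ({rim i, rim (i + 1)} : Finset (Vert n)) ⊆ rimTriangle i := by
      simp [rimTriangle, Finset.subset_iff]
    refine ⟨⟨by simp, i, .inr (.inl hsub)⟩,
      Finset.card_pair (by simpa using (ne1 i).symm), rimTriangle i,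
      ⟨(mem_triangles_wheel hn _).2 ⟨i, .inr (.inl rfl)⟩, hsub⟩, ?_⟩
    rintro t ⟨ht, hst⟩
    obtain ⟨j, rfl | rfl | rfl⟩ := (mem_triangles_wheel hn _).1 ht
    · have := hst (Finset.mem_insert_self _ _)
      simp [hubTriangle] at this
    · have h1 : rim i ∈ _ := hst (by simp)
      have h2 : rim (i + 1) ∈ _ := hst (by simp)
      simp [rimTriangle] at h1 h2
      rcases h1 with rfl | h1
      · rfl
      · rcases h2 with h2 | rfl
        · exact absurd (by rw [h2, ← h1]) (ne2 i)
        · rfl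
    · have h1 : rim i ∈ _ := hst (by simp)
      have h2 : rim (i + 1) ∈ _ := hst (by simp)
      simp [midTriangle] at h1 h2
      exact absurd (h1.symm.trans h2) (ne1 j)

end Wheel

/-! ### Barycentric coordinates by sectors -/

section SectorCoordinates

variable {n : ℕ} [NeZero n]

/-- Barycentric coordinates of the points in the union of the three triangles with the same index:
`β`, `β'` belong to the rim, `ω`, `ω'` to the inner cycle, `γ` to the hub. -/
structure IsSector (β β' ω ω' γ : ℝ) : Prop where
  nonneg₁ : 0 ≤ β
  nonneg₂ : 0 ≤ β'
  nonneg₃ : 0 ≤ ω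
  nonneg₄ : 0 ≤ ω'
  nonneg₅ : 0 ≤ γ
  sum_eq : β + β' + ω + ω' + γ = 1
  hub_rim : γ * β = 0
  hub_rim' : γ * β' = 0
  diag : β * ω' = 0

/-- The point with given barycentric coordinates in the `i`-th sector. -/
def sectorPoint (i : Fin n) (β β' ω ω' γ : ℝ) : Vert n → ℝ :=
  Pi.single (rim i) β + Pi.single (rim (i + 1)) β' + Pi.single (mid i) ω +
    Pi.single (mid (i + 1)) ω' + Pi.single hub γ

theorem realize_add {V E : Type*} [Fintype V] [AddCommGroup E] [Module ℝ E] (p : V → E)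
    (x y : V → ℝ) : realize p (x + y) = realize p x + realize p y := by
  simp [realize, add_smul, Finset.sum_add_distrib]

theorem realize_single {V E : Type*} [Fintype V] [DecidableEq V] [AddCommGroup E] [Module ℝ E]
    (p : V → E) (v : V) (s : ℝ) : realize p (Pi.single v s) = s • p v := by
  simp [realize, Pi.single_apply]

theorem realize_sectorPoint {E : Type*} [AddCommGroup E] [Module ℝ E] (p : Vert n → E) (i : Fin n)
    (β β' ω ω' γ : ℝ) : realize p (sectorPoint i β β' ω ω' γ) =
      β • p (rim i) + β' • p (rim (i + 1)) + ω • p (mid i) + ω' • p (mid (i + 1)) + γ • p hub := by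
  simp only [sectorPoint, realize_add, realize_single]

theorem sectorPoint_rim (hn : 3 ≤ n) (i : Fin n) (β β' ω ω' γ : ℝ) :
    sectorPoint i β β' ω ω' γ (rim i) = β := by
  simp [sectorPoint, (add_one_ne hn i).symm]

theorem sectorPoint_rim_succ (hn : 3 ≤ n) (i : Fin n) (β β' ω ω' γ : ℝ) :
    sectorPoint i β β' ω ω' γ (rim (i + 1)) = β' := by
  simp [sectorPoint, add_one_ne hn i]

theorem sectorPoint_mid (hn : 3 ≤ n) (i : Fin n) (β β' ω ω' γ : ℝ) :
    sectorPoint i β β' ω ω' γ (mid i) = ω := by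
  simp [sectorPoint, (add_one_ne hn i).symm]

theorem sectorPoint_mid_succ (hn : 3 ≤ n) (i : Fin n) (β β' ω ω' γ : ℝ) :
    sectorPoint i β β' ω ω' γ (mid (i + 1)) = ω' := by
  simp [sectorPoint, add_one_ne hn i]

theorem sectorPoint_hub (i : Fin n) (β β' ω ω' γ : ℝ) :
    sectorPoint i β β' ω ω' γ hub = γ := by
  simp [sectorPoint]

theorem sectorPoint_rim_of_ne (i j : Fin n) (β β' ω ω' γ : ℝ) (h : j ≠ i) (h' : j ≠ i + 1) :
    sectorPoint i β β' ω ω' γ (rim j) = 0 := by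
  simp [sectorPoint, h, h']

theorem sectorPoint_mid_of_ne (i j : Fin n) (β β' ω ω' γ : ℝ) (h : j ≠ i) (h' : j ≠ i + 1) :
    sectorPoint i β β' ω ω' γ (mid j) = 0 := by
  simp [sectorPoint, h, h']

theorem sectorPoint_mem_stdSimplex {i : Fin n} {β β' ω ω' γ : ℝ} (h₁ : 0 ≤ β) (h₂ : 0 ≤ β')
    (h₃ : 0 ≤ ω) (h₄ : 0 ≤ ω') (h₅ : 0 ≤ γ) (hs : β + β' + ω + ω' + γ = 1) :
    sectorPoint i β β' ω ω' γ ∈ stdSimplex ℝ (Vert n) := by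
  constructor
  · intro v
    have : ∀ (w : Vert n) (s : ℝ), 0 ≤ s → 0 ≤ (Pi.single w s : Vert n → ℝ) v := fun w s hs => by
      rw [Pi.single_apply]; split_ifs <;> simp [hs]
    simp only [sectorPoint, Pi.add_apply]
    exact add_nonneg (add_nonneg (add_nonneg (add_nonneg (this _ _ h₁) (this _ _ h₂))
      (this _ _ h₃)) (this _ _ h₄)) (this _ _ h₅)
  · simp only [sectorPoint, Pi.add_apply, Finset.sum_add_distrib, Finset.sum_pi_single',
      Finset.mem_univ, if_true]
    exact hs

/-- The vanishing products select the triangle: γ ≠ 0 forces the hub triangle, and otherwise `diag`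
leaves the mid or the rim triangle. -/
theorem IsSector.mem_realization {i : Fin n} {β β' ω ω' γ : ℝ} (h : IsSector β β' ω ω' γ) :
    sectorPoint i β β' ω ω' γ ∈ realization (wheel n) := by
  refine ⟨sectorPoint_mem_stdSimplex h.1 h.2 h.3 h.4 h.5 h.6, ?_⟩
  by_cases hγ : γ = 0
  · rcases mul_eq_zero.1 h.diag with hβ | hω
    · refine ⟨midTriangle i, ⟨by simp [midTriangle], i, .inr (.inr subset_rfl)⟩, fun v hv => ?_⟩
      simp only [midTriangle, Finset.mem_insert, Finset.mem_singleton, not_or] at hv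
      simp [sectorPoint, hγ, hβ, hv]
    · refine ⟨rimTriangle i, ⟨by simp [rimTriangle], i, .inr (.inl subset_rfl)⟩, fun v hv => ?_⟩
      simp only [rimTriangle, Finset.mem_insert, Finset.mem_singleton, not_or] at hv
      simp [sectorPoint, hγ, hω, hv]
  · have h1 := (mul_eq_zero.1 h.hub_rim).resolve_left hγ
    have h2 := (mul_eq_zero.1 h.hub_rim').resolve_left hγ
    refine ⟨hubTriangle i, ⟨by simp [hubTriangle], i, .inl subset_rfl⟩, fun v hv => ?_⟩
    simp only [hubTriangle, Finset.mem_insert, Finset.mem_singleton, not_or] at hv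
    simp [sectorPoint, h1, h2, hv]

theorem eq_sum_single_of_support {V : Type*} [Fintype V] [DecidableEq V] (x : V → ℝ) (s : Finset V)
    (h : ∀ v, v ∉ s → x v = 0) : x = ∑ v ∈ s, Pi.single v (x v) := by
  ext w
  simp only [Finset.sum_apply, Pi.single_apply, Finset.sum_ite_eq]
  split_ifs with hw
  exacts [rfl, h w hw]

theorem exists_isSector (hn : 3 ≤ n) {x : Vert n → ℝ} (hx : x ∈ realization (wheel n)) :
    ∃ i β β' ω ω' γ, IsSector β β' ω ω' γ ∧ x = sectorPoint i β β' ω ω' γ := by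
  obtain ⟨⟨h0, h1⟩, s, ⟨-, i, hi⟩, hs⟩ := hx
  have ne := (add_one_ne hn i).symm
  rcases hi with hi | hi | hi
  · have e := eq_sum_single_of_support x (hubTriangle i) fun v hv => hs v fun h => hv (hi h)
    rw [hubTriangle, Finset.sum_insert (by simpa using ne), Finset.sum_insert (by simp),
      Finset.sum_singleton] at e
    refine ⟨i, 0, 0, x (mid i), x (mid (i + 1)), x hub,
      ⟨le_rfl, le_rfl, h0 _, h0 _, h0 _, ?_, by simp, by simp, by simp⟩, ?_⟩
    · rw [← h1]
      conv_rhs => rw [e]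
      simp only [Pi.add_apply, Finset.sum_add_distrib, Finset.sum_pi_single',
        Finset.mem_univ, if_true]
      ring
    · conv_lhs => rw [e]
      simp [sectorPoint, add_assoc]
  · have e := eq_sum_single_of_support x (rimTriangle i) fun v hv => hs v fun h => hv (hi h)
    rw [rimTriangle, Finset.sum_insert (by simpa using ne), Finset.sum_insert (by simp),
      Finset.sum_singleton] at e
    refine ⟨i, x (rim i), x (rim (i + 1)), x (mid i), 0, 0,
      ⟨h0 _, h0 _, h0 _, le_rfl, le_rfl, ?_, by simp, by simp, by simp⟩, ?_⟩
    · rw [← h1]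
      conv_rhs => rw [e]
      simp only [Pi.add_apply, Finset.sum_add_distrib, Finset.sum_pi_single',
        Finset.mem_univ, if_true]
      ring
    · conv_lhs => rw [e]
      simp [sectorPoint, add_assoc]
  · have e := eq_sum_single_of_support x (midTriangle i) fun v hv => hs v fun h => hv (hi h)
    rw [midTriangle, Finset.sum_insert (by simp), Finset.sum_insert (by simpa using ne),
      Finset.sum_singleton] at e
    refine ⟨i, 0, x (rim (i + 1)), x (mid i), x (mid (i + 1)), 0,
      ⟨le_rfl, h0 _, h0 _, h0 _, le_rfl, ?_, by simp, by simp, by simp⟩, ?_⟩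
    · rw [← h1]
      conv_rhs => rw [e]
      simp only [Pi.add_apply, Finset.sum_add_distrib, Finset.sum_pi_single',
        Finset.mem_univ, if_true]
      ring
    · conv_lhs => rw [e]
      simp [sectorPoint, add_assoc]

theorem mem_boundary_wheel (hn : 3 ≤ n) {x : Vert n → ℝ} :
    x ∈ boundary (wheel n) ↔ ∃ i s, s ∈ Set.Ico (0 : ℝ) 1 ∧ x = sectorPoint i (1 - s) s 0 0 0 := by
  constructor
  · rintro ⟨⟨h0, h1⟩, e, he, hx⟩
    obtain ⟨i, rfl⟩ := (mem_boundaryEdges_wheel hn e).1 he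
    have e := eq_sum_single_of_support x _ hx
    rw [Finset.sum_pair (by simpa using (add_one_ne hn i).symm)] at e
    have hsum : x (rim i) + x (rim (i + 1)) = 1 := by
      rw [← h1]
      conv_rhs => rw [e]
      simp only [Pi.add_apply, Finset.sum_add_distrib, Finset.sum_pi_single',
        Finset.mem_univ, if_true]
    -- The parameter is half-open, as in `IsEmbeddedPolygon`, so the end of an edge is recorded as
    -- the start of the next one.
    by_cases h : x (rim (i + 1)) = 1
    · refine ⟨i + 1, 0, by simp, ?_⟩
      rw [e, h, show x (rim i) = 0 by linarith]
      simp [sectorPoint]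
    · refine ⟨i, x (rim (i + 1)), ⟨h0 _, lt_of_le_of_ne ?_ h⟩, ?_⟩
      · linarith [h0 (rim i)]
      · rw [← eq_sub_iff_add_eq] at hsum
        rw [← hsum]
        conv_lhs => rw [e]
        simp [sectorPoint]
  · rintro ⟨i, s, ⟨hs0, hs1⟩, rfl⟩
    refine ⟨sectorPoint_mem_stdSimplex (by linarith) hs0 le_rfl le_rfl le_rfl (by ring),
      {rim i, rim (i + 1)}, (mem_boundaryEdges_wheel hn _).2 ⟨i, rfl⟩, fun v hv => ?_⟩
    simp only [Finset.mem_insert, Finset.mem_singleton, not_or] at hv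
    simp [sectorPoint, hv]

theorem sectorPoint_mem_boundary (hn : 3 ≤ n) {i : Fin n} {β β' : ℝ} (h : 0 ≤ β) (h' : 0 ≤ β')
    (hs : β + β' = 1) : sectorPoint i β β' 0 0 0 ∈ boundary (wheel n) := by
  refine ⟨sectorPoint_mem_stdSimplex h h' le_rfl le_rfl le_rfl (by linarith),
    {rim i, rim (i + 1)}, (mem_boundaryEdges_wheel hn _).2 ⟨i, rfl⟩, fun v hv => ?_⟩
  simp only [Finset.mem_insert, Finset.mem_singleton, not_or] at hv
  simp [sectorPoint, hv]

end SectorCoordinates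

/-! ### Compactness, continuity and polyhedral graphs -/

section Generic

theorem isCompact_realization {V : Type*} [Fintype V] (K : AbstractSimplicialComplex V) :
    IsCompact (realization K) := by
  have : realization K =
      stdSimplex ℝ V ∩ ⋃ s ∈ K.faces, ⋂ v, {x : V → ℝ | v ∉ s → x v = 0} := by
    ext x; simp [realization]
  rw [this]
  refine (isCompact_stdSimplex ℝ V).inter_right ?_
  refine (Set.toFinite _).isClosed_biUnion fun s _ => isClosed_iInter fun v => ?_
  by_cases hv : v ∈ s
  · simp [hv]
  · simpa [hv] using isClosed_eq (continuous_apply v) continuous_const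

theorem continuous_realize {V E : Type*} [Fintype V] [AddCommGroup E] [Module ℝ E]
    [TopologicalSpace E] [ContinuousAdd E] [ContinuousSMul ℝ E] (p : V → E) :
    Continuous (realize p) := by
  unfold realize; fun_prop

/-- Over a face s the graph is the convex hull of the points (e_v, g v) with v in s, as the second
component is linear in the first. -/
theorem isPolyhedron_range_realize {V E : Type*} [Fintype V] [AddCommGroup E]
    [Module ℝ E] (K : AbstractSimplicialComplex V) (g : V → E) :
    IsPolyhedron (Set.range fun x : realization K => ((x : V → ℝ), realize g x)) := by
  classical
  refine ⟨K.faces.toFinite.toFinset.image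
    fun s => s.image fun v => ((Pi.single v 1 : V → ℝ), g v), ?_⟩
  ext ⟨x, y⟩
  simp only [Set.mem_range, Subtype.exists, Prod.mk.injEq, Finset.mem_image, Set.mem_iUnion,
    exists_prop, Set.Finite.mem_toFinset]
  constructor
  · rintro ⟨x, ⟨⟨h0, h1⟩, s, hs, hx⟩, rfl, rfl⟩
    refine ⟨_, ⟨s, hs, rfl⟩, ?_⟩
    have hsum : ∑ v ∈ s, x v = 1 := by
      rw [← h1]
      exact Finset.sum_subset (Finset.subset_univ s) fun v _ hv => hx v hv
    have := (convex_convexHull ℝ (((fun v => ((Pi.single v 1 : V → ℝ), g v)) '' (s : Set V)))).sum_mem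
      (t := s) (w := x) (z := fun v => ((Pi.single v 1 : V → ℝ), g v)) (fun v _ => h0 v) hsum
      (fun v hv => subset_convexHull ℝ _ (Set.mem_image_of_mem _ hv))
    rw [Finset.coe_image]
    convert this using 1
    ext1
    · rw [Prod.fst_sum]
      conv_lhs => rw [eq_sum_single_of_support x s hx]
      simp only [Prod.smul_fst, ← Pi.single_smul, smul_eq_mul, mul_one]
    · rw [Prod.snd_sum]
      simp only [Prod.smul_snd, realize]
      exact (Finset.sum_subset (Finset.subset_univ s) fun v _ hv => by rw [hx v hv, zero_smul]).symm
  · rintro ⟨_, ⟨s, hs, rfl⟩, h⟩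
    have hconv : Convex ℝ {z : (V → ℝ) × E | z.1 ∈ stdSimplex ℝ V ∧ (∀ v, v ∉ s → z.1 v = 0) ∧
        z.2 = realize g z.1} := by
      rintro z ⟨hz1, hz2, hz3⟩ w ⟨hw1, hw2, hw3⟩ a b ha hb hab
      refine ⟨convex_stdSimplex ℝ V hz1 hw1 ha hb hab, fun v hv => ?_, ?_⟩
      · simp [hz2 v hv, hw2 v hv]
      · simp [hz3, hw3, realize, add_smul, Finset.sum_add_distrib, Finset.smul_sum, mul_smul]
    rw [Finset.coe_image] at h
    have := convexHull_min (s := (fun v => ((Pi.single v 1 : V → ℝ), g v)) '' (s : Set V)) ?_ hconv h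
    · obtain ⟨h1, h2, h3⟩ := this
      exact ⟨x, ⟨h1, s, hs, h2⟩, rfl, h3.symm⟩
    · rintro _ ⟨v, hv, rfl⟩
      refine ⟨single_mem_stdSimplex ℝ v, fun w hw => ?_, ?_⟩
      · exact Pi.single_eq_of_ne (ne_of_mem_of_not_mem (Finset.mem_coe.1 hv) hw).symm _
      · simp [realize_single]

end Generic

/-! ### The regular n-gon and its fan of sectors -/

section Fan

open Real

variable {n : ℕ} [NeZero n]

/-- The vertices of a regular `n`-gon, in real coordinates. -/
noncomputable def ngonX (i : Fin n) : ℝ := cos (i.val * (2 * π / n))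
noncomputable def ngonY (i : Fin n) : ℝ := sin (i.val * (2 * π / n))

/-- The linear functional that is `1` on the `k`-th edge of the regular `n`-gon. -/
noncomputable def gauge (k : Fin n) (x y : ℝ) : ℝ :=
  (x * (ngonY (k + 1) - ngonY k) - y * (ngonX (k + 1) - ngonX k)) / sin (2 * π / n)

theorem val_add_one_eq (hn : 3 ≤ n) (i : Fin n) : (i + 1).val = (i.val + 1) % n := by
  rw [Fin.val_add, Fin.val_one', Nat.mod_eq_of_lt (show 1 < n by omega)]

theorem mod_mul_angle (a : ℕ) : ((a : ℝ) * (2 * π / n)) =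
    ((a % n : ℕ) : ℝ) * (2 * π / n) + (a / n : ℕ) * (2 * π) := by
  have hn0 : (n : ℝ) ≠ 0 := Nat.cast_ne_zero.2 (NeZero.ne n)
  have : (a : ℝ) = ((a % n : ℕ) : ℝ) + n * ((a / n : ℕ) : ℝ) := by
    exact_mod_cast (Nat.mod_add_div a n).symm
  conv_lhs => rw [this]
  field_simp

theorem ngonX_succ (hn : 3 ≤ n) (i : Fin n) :
    ngonX (i + 1) = cos ((i.val + 1) * (2 * π / n)) := by
  have := mod_mul_angle (n := n) (i.val + 1)
  rw [ngonX, val_add_one_eq hn, ← cos_add_nat_mul_two_pi _ ((i.val + 1) / n), ← this]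
  push_cast; rfl

theorem ngonY_succ (hn : 3 ≤ n) (i : Fin n) :
    ngonY (i + 1) = sin ((i.val + 1) * (2 * π / n)) := by
  have := mod_mul_angle (n := n) (i.val + 1)
  rw [ngonY, val_add_one_eq hn, ← sin_add_nat_mul_two_pi _ ((i.val + 1) / n), ← this]
  push_cast; rfl

theorem ngonX_add_one (hn : 3 ≤ n) (i : Fin n) : ngonX (i + 1) =
    ngonX i * cos (2 * π / n) - ngonY i * sin (2 * π / n) := by
  rw [ngonX_succ hn, add_one_mul, cos_add, ngonX, ngonY]

theorem ngonY_add_one (hn : 3 ≤ n) (i : Fin n) : ngonY (i + 1) =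
    ngonY i * cos (2 * π / n) + ngonX i * sin (2 * π / n) := by
  rw [ngonY_succ hn, add_one_mul, sin_add, ngonX, ngonY]

omit [NeZero n] in
theorem ngon_sq (i : Fin n) : ngonX i ^ 2 + ngonY i ^ 2 = 1 := cos_sq_add_sin_sq _

omit [NeZero n] in
theorem angle_pos (hn : 3 ≤ n) : 0 < 2 * π / n := by
  have : (0 : ℝ) < n := by exact_mod_cast (by omega : 0 < n)
  have := pi_pos
  positivity

omit [NeZero n] in
theorem angle_lt_pi (hn : 3 ≤ n) : 2 * π / n < π := by
  have : (3 : ℝ) ≤ n := by exact_mod_cast hn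
  rw [div_lt_iff₀ (by linarith)]
  nlinarith [pi_pos]

omit [NeZero n] in
theorem sin_angle_pos (hn : 3 ≤ n) : 0 < sin (2 * π / n) :=
  sin_pos_of_pos_of_lt_pi (angle_pos hn) (angle_lt_pi hn)

omit [NeZero n] in
theorem cos_angle_lt_one (hn : 3 ≤ n) : cos (2 * π / n) < 1 := by
  have h := sin_angle_pos hn
  nlinarith [sin_sq_add_cos_sq (2 * π / n)]

theorem det_ngon (hn : 3 ≤ n) (i : Fin n) :
    ngonX i * ngonY (i + 1) - ngonX (i + 1) * ngonY i = sin (2 * π / n) := by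
  rw [ngonX_add_one hn, ngonY_add_one hn]
  linear_combination sin (2 * π / n) * ngon_sq i

theorem ngonX_recurrence (hn : 3 ≤ n) (i : Fin n) :
    ngonX i + ngonX (i + 1 + 1) = 2 * cos (2 * π / n) * ngonX (i + 1) := by
  rw [ngonX_add_one hn (i + 1), ngonX_add_one hn, ngonY_add_one hn]
  linear_combination (-ngonX i) * sin_sq_add_cos_sq (2 * π / n)

theorem ngonY_recurrence (hn : 3 ≤ n) (i : Fin n) :
    ngonY i + ngonY (i + 1 + 1) = 2 * cos (2 * π / n) * ngonY (i + 1) := by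
  rw [ngonY_add_one hn (i + 1), ngonX_add_one hn, ngonY_add_one hn]
  linear_combination (-ngonY i) * sin_sq_add_cos_sq (2 * π / n)

/-- Summing the recurrence over the cycle gives 2S = 2 cos(2π/n) S, and the cosine is less than 1.
-/
theorem sum_ngon (hn : 3 ≤ n) : ∑ i : Fin n, ngonX i = 0 ∧ ∑ i : Fin n, ngonY i = 0 := by
  have h1 : ∀ f : Fin n → ℝ, ∑ i, f (i + 1) = ∑ i, f i := fun f =>
    Equiv.sum_comp (Equiv.addRight 1) f
  have hc := cos_angle_lt_one hn
  constructor
  · have := Finset.sum_congr rfl fun (i : Fin n) (_ : i ∈ Finset.univ) => ngonX_recurrence hn i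
    rw [Finset.sum_add_distrib, ← Finset.mul_sum, h1 fun i => ngonX (i + 1), h1] at this
    have h : (1 - cos (2 * π / n)) * ∑ i : Fin n, ngonX i = 0 := by linarith
    exact (mul_eq_zero.1 h).resolve_left (by linarith)
  · have := Finset.sum_congr rfl fun (i : Fin n) (_ : i ∈ Finset.univ) => ngonY_recurrence hn i
    rw [Finset.sum_add_distrib, ← Finset.mul_sum, h1 fun i => ngonY (i + 1), h1] at this
    have h : (1 - cos (2 * π / n)) * ∑ i : Fin n, ngonY i = 0 := by linarith
    exact (mul_eq_zero.1 h).resolve_left (by linarith)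

theorem gauge_self (hn : 3 ≤ n) (k : Fin n) : gauge k (ngonX k) (ngonY k) = 1 := by
  rw [gauge, div_eq_one_iff_eq (sin_angle_pos hn).ne', ← det_ngon hn k]; ring

theorem gauge_succ (hn : 3 ≤ n) (k : Fin n) : gauge k (ngonX (k + 1)) (ngonY (k + 1)) = 1 := by
  rw [gauge, div_eq_one_iff_eq (sin_angle_pos hn).ne', ← det_ngon hn k]; ring

theorem gauge_combination (k : Fin n) (s t x y x' y' : ℝ) :
    gauge k (s * x + t * x') (s * y + t * y') = s * gauge k x y + t * gauge k x' y' := by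
  simp only [gauge]; ring

theorem cos_lt_cos_of_lt_of_lt_two_pi_sub {a b : ℝ} (ha : 0 ≤ a) (h1 : a < b)
    (h2 : b < 2 * π - a) : cos b < cos a := by
  rcases le_total b π with hb | hb
  · exact cos_lt_cos_of_nonneg_of_le_pi ha hb h1
  · rw [← cos_two_pi_sub]
    exact cos_lt_cos_of_nonneg_of_le_pi ha (by linarith) (by linarith)

/-- Put θ = 2π/n. Up to the factor 2 sin(θ/2) / sin θ, the gauge is the cosine of the angle from
vertex j to the midpoint of edge k. This angle is θ/2 at the ends of the edge and lies strictly
between θ/2 and 2π − θ/2 at all other vertices. -/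
theorem gauge_ngon_lt (hn : 3 ≤ n) {j k : Fin n} (h : j ≠ k) (h' : j ≠ k + 1) :
    gauge k (ngonX j) (ngonY j) < 1 := by
  rw [gauge, div_lt_one (sin_angle_pos hn), ngonX_succ hn, ngonY_succ hn]
  simp only [ngonX, ngonY]
  set θ := 2 * π / n with hθ
  have hθ0 : 0 < θ := angle_pos hn
  have hn0 : (0 : ℝ) < n := by exact_mod_cast (by omega : 0 < n)
  have hnθ : n * θ = 2 * π := by rw [hθ]; field_simp
  have e : cos (j.val * θ) * (sin ((k.val + 1) * θ) - sin (k.val * θ)) -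
      sin (j.val * θ) * (cos ((k.val + 1) * θ) - cos (k.val * θ)) =
      2 * sin (θ / 2) * cos (|(k.val : ℝ) - j.val + 1 / 2| * θ) := by
    have : |(k.val : ℝ) - j.val + 1 / 2| * θ = |((k.val : ℝ) - j.val + 1 / 2) * θ| := by
      rw [abs_mul, abs_of_pos hθ0]
    rw [this, cos_abs]
    have a1 : ((k.val : ℝ) + 1) * θ = j.val * θ + (((k.val : ℝ) - j.val + 1 / 2) * θ + θ / 2) := by
      ring
    have a2 : (k.val : ℝ) * θ = j.val * θ + (((k.val : ℝ) - j.val + 1 / 2) * θ - θ / 2) := by ring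
    rw [a1, a2]
    generalize (j.val : ℝ) * θ = u
    generalize ((k.val : ℝ) - j.val + 1 / 2) * θ = v
    simp only [sin_add, cos_add, sin_sub, cos_sub]
    linear_combination (2 * sin (θ / 2) * cos v) * sin_sq_add_cos_sq u
  have e' : sin θ = 2 * sin (θ / 2) * cos (θ / 2) := by rw [← sin_two_mul]; ring_nf
  rw [e, e']
  have hs : 0 < sin (θ / 2) := sin_pos_of_pos_of_lt_pi (by linarith)
    (by have := angle_lt_pi hn; linarith)
  refine mul_lt_mul_of_pos_left ?_ (by linarith)
  have hj := j.isLt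
  have hk := k.isLt
  have hne : j.val ≠ k.val := fun h0 => h (Fin.ext h0)
  have hne' : j.val ≠ (k.val + 1) % n := fun h0 => h' (Fin.ext (by rw [h0, val_add_one_eq hn]))
  have key : 1 / 2 < |(k.val : ℝ) - j.val + 1 / 2| ∧ |(k.val : ℝ) - j.val + 1 / 2| < n - 1 / 2 := by
    rcases lt_or_gt_of_ne hne with hlt | hlt
    · have h1 : (j.val : ℝ) + 1 ≤ k.val := by exact_mod_cast hlt
      have h2 : (k.val : ℝ) + 2 ≤ n + j.val := by
        have : k.val + 2 ≤ n + j.val := by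
          by_contra hcon
          have e1 : k.val + 1 = n := by omega
          rw [e1, Nat.mod_self] at hne'
          omega
        exact_mod_cast this
      rw [abs_of_pos (by linarith)]
      constructor <;> linarith
    · have h1 : (k.val : ℝ) + 2 ≤ j.val := by
        have : k.val + 2 ≤ j.val := by
          by_contra hcon
          have e1 : k.val + 1 = j.val := by omega
          rw [e1, Nat.mod_eq_of_lt hj] at hne'
          exact hne' rfl
        exact_mod_cast this
      have h2 : (j.val : ℝ) + 1 ≤ n := by exact_mod_cast hj
      have h3 : (0 : ℝ) ≤ k.val := Nat.cast_nonneg _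
      rw [abs_of_neg (by linarith)]
      constructor <;> linarith
  refine cos_lt_cos_of_lt_of_lt_two_pi_sub (by linarith) ?_ ?_
  · nlinarith [key.1]
  · rw [← hnθ]
    nlinarith [key.2]

theorem gauge_ngon_le (hn : 3 ≤ n) (j k : Fin n) : gauge k (ngonX j) (ngonY j) ≤ 1 := by
  by_cases h : j = k
  · exact (by rw [h, gauge_self hn] : _ = (1 : ℝ)).le
  by_cases h' : j = k + 1
  · exact (by rw [h', gauge_succ hn] : _ = (1 : ℝ)).le
  exact (gauge_ngon_lt hn h h').le

theorem gauge_sector (hn : 3 ≤ n) (i : Fin n) (s t : ℝ) :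
    gauge i (s * ngonX i + t * ngonX (i + 1)) (s * ngonY i + t * ngonY (i + 1)) = s + t := by
  rw [gauge_combination, gauge_self hn, gauge_succ hn]; ring

theorem gauge_sector_le (hn : 3 ≤ n) (i k : Fin n) {s t : ℝ} (hs : 0 ≤ s) (ht : 0 ≤ t) :
    gauge k (s * ngonX i + t * ngonX (i + 1)) (s * ngonY i + t * ngonY (i + 1)) ≤ s + t := by
  rw [gauge_combination]
  nlinarith [gauge_ngon_le hn i k, gauge_ngon_le hn (i + 1) k]

/-- The sectors of the regular `n`-gon cover the plane. -/
theorem exists_sector (hn : 3 ≤ n) (x y : ℝ) : ∃ (i : Fin n) (s t : ℝ), 0 ≤ s ∧ 0 ≤ t ∧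
    x = s * ngonX i + t * ngonX (i + 1) ∧ y = s * ngonY i + t * ngonY (i + 1) := by
  -- The edge of largest gauge faces the point: by the recurrence, comparing with the gauges of its
  -- two neighbours says exactly that both Cramer coordinates are nonnegative.
  obtain ⟨k, hk⟩ := Finite.exists_max fun k : Fin n => gauge k x y
  have hS := sin_angle_pos hn
  have hc := cos_angle_lt_one hn
  have d := det_ngon hn k
  refine ⟨k, (x * ngonY (k + 1) - y * ngonX (k + 1)) / sin (2 * π / n),
    (ngonX k * y - ngonY k * x) / sin (2 * π / n), ?_, ?_, ?_, ?_⟩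
  · refine div_nonneg ?_ hS.le
    have h := hk (k + 1)
    simp only [gauge] at h
    rw [div_le_div_iff_of_pos_right hS] at h
    have r1 := ngonX_recurrence hn k
    have r2 := ngonY_recurrence hn k
    have : 0 ≤ (1 - cos (2 * π / n)) * (x * ngonY (k + 1) - y * ngonX (k + 1)) := by
      linear_combination (1 / 2) * h - x / 2 * r2 + y / 2 * r1
    exact nonneg_of_mul_nonneg_right this (by linarith)
  · refine div_nonneg ?_ hS.le
    have h := hk (k - 1)
    simp only [gauge] at h
    rw [div_le_div_iff_of_pos_right hS] at h
    have r1 := ngonX_recurrence hn (k - 1)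
    have r2 := ngonY_recurrence hn (k - 1)
    rw [sub_add_cancel] at h r1 r2
    have : 0 ≤ (1 - cos (2 * π / n)) * (ngonX k * y - ngonY k * x) := by
      linear_combination (1 / 2) * h + x / 2 * r2 - y / 2 * r1
    exact nonneg_of_mul_nonneg_right this (by linarith)
  · field_simp
    linear_combination -x * d
  · field_simp
    linear_combination -y * d

/-- Coordinates in the sectors of the regular `n`-gon are unique up to shared rays. -/
theorem sector_unique (hn : 3 ≤ n) {i k : Fin n} {s t s' t' : ℝ} (hs : 0 ≤ s) (ht : 0 ≤ t)
    (hs' : 0 ≤ s') (ht' : 0 ≤ t')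
    (hx : s * ngonX i + t * ngonX (i + 1) = s' * ngonX k + t' * ngonX (k + 1))
    (hy : s * ngonY i + t * ngonY (i + 1) = s' * ngonY k + t' * ngonY (k + 1)) :
    (k = i ∧ s = s' ∧ t = t') ∨ (k = i + 1 ∧ s = 0 ∧ t' = 0 ∧ t = s') ∨
      (i = k + 1 ∧ s' = 0 ∧ t = 0 ∧ s = t') ∨ (s = 0 ∧ t = 0 ∧ s' = 0 ∧ t' = 0) := by
  have hsum : s + t = s' + t' := by
    apply le_antisymm
    · rw [← gauge_sector hn i, hx, hy]
      exact gauge_sector_le hn k i hs' ht'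
    · rw [← gauge_sector hn k, ← hx, ← hy]
      exact gauge_sector_le hn i k hs ht
  -- Equality holds in the gauge bound, so a vertex of edge k with positive weight must be a vertex
  -- of edge i.
  have A : ∀ {i k : Fin n} {s t s' t' : ℝ}, 0 ≤ s → 0 ≤ t → 0 ≤ s' → 0 ≤ t' →
      s * ngonX i + t * ngonX (i + 1) = s' * ngonX k + t' * ngonX (k + 1) →
      s * ngonY i + t * ngonY (i + 1) = s' * ngonY k + t' * ngonY (k + 1) → s + t = s' + t' →
      (s' = 0 ∨ k = i ∨ k = i + 1) ∧ (t' = 0 ∨ k + 1 = i ∨ k = i) := by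
    intro i k s t s' t' hs ht hs' ht' hx hy hsum
    have h := gauge_sector hn i s t
    rw [hx, hy, hsum, gauge_combination] at h
    have l1 := gauge_ngon_le hn k i
    have l2 := gauge_ngon_le hn (k + 1) i
    constructor
    · by_contra! hcon
      have := gauge_ngon_lt hn hcon.2.1 hcon.2.2
      have : 0 < s' := lt_of_le_of_ne hs' hcon.1.symm
      nlinarith
    · by_contra! hcon
      have := gauge_ngon_lt hn hcon.2.1 (fun h => hcon.2.2 (add_right_cancel h))
      have : 0 < t' := lt_of_le_of_ne ht' hcon.1.symm
      nlinarith
  obtain ⟨a1, a2⟩ := A hs ht hs' ht' hx hy hsum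
  obtain ⟨b1, b2⟩ := A hs' ht' hs ht hx.symm hy.symm hsum.symm
  by_cases hk : k = i
  · subst hk
    have d := det_ngon hn k
    have hS := (sin_angle_pos hn).ne'
    have hss : s = s' := by
      apply mul_right_cancel₀ hS
      rw [← d]
      linear_combination ngonY (k + 1) * hx - ngonX (k + 1) * hy
    exact .inl ⟨rfl, hss, by linarith⟩
  · have hk' : ¬ i = k := fun h => hk h.symm
    have n1 := add_one_add_one_ne hn i
    have n2 := add_one_add_one_ne hn k
    simp only [hk, hk', or_false, false_or] at a1 a2 b1 b2
    by_cases h1 : k = i + 1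
    · have h2 : ¬ k + 1 = i := fun h => n1 (h1 ▸ h)
      have h3 : ¬ i = k + 1 := fun h => h2 h.symm
      simp only [h2, h3, or_false] at a2 b1
      exact .inr (.inl ⟨h1, b1, a2, by linarith⟩)
    · have h1' : ¬ i + 1 = k := fun h => h1 h.symm
      simp only [h1, h1', or_false] at a1 b2
      by_cases h2 : i = k + 1
      · exact .inr (.inr (.inl ⟨h2, a1, b2, by linarith⟩))
      · have h3 : ¬ k + 1 = i := fun h => h2 h.symm
        simp only [h2, h3, or_false] at a2 b1
        exact .inr (.inr (.inr ⟨b1, b2, a1, a2⟩))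

end Fan

/-! ### The planar model is a PL disk -/

section Disk

open Real

variable {n : ℕ} [NeZero n]

/-- The vertices of a planar model of the wheel. -/
noncomputable def planeVertex : Vert n → EuclideanSpace ℝ (Fin 2)
  | .inl i => !₂[2 * ngonX i, 2 * ngonY i]
  | .inr (.inl i) => !₂[ngonX i, ngonY i]
  | .inr (.inr _) => 0

theorem realize_planeVertex (i : Fin n) (β β' ω ω' γ : ℝ) :
    realize planeVertex (sectorPoint i β β' ω ω' γ) =
      !₂[(2 * β + ω) * ngonX i + (2 * β' + ω') * ngonX (i + 1),
        (2 * β + ω) * ngonY i + (2 * β' + ω') * ngonY (i + 1)] := by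
  rw [realize_sectorPoint]
  ext k
  fin_cases k <;> simp [planeVertex] <;> ring

/-- The sum of the two given quantities is 1 − γ + (β + β'), where γ and β + β' are never both
nonzero; so it determines each of them. In the collar, `diag` then separates β from β'. -/
theorem IsSector.coord_eq {β β' ω ω' γ b b' w w' c : ℝ} (h : IsSector β β' ω ω' γ)
    (h' : IsSector b b' w w' c) (h1 : 2 * β + ω = 2 * b + w) (h2 : 2 * β' + ω' = 2 * b' + w') :
    β = b ∧ β' = b' ∧ ω = w ∧ ω' = w' ∧ γ = c := by
  obtain ⟨p1, p2, p3, p4, p5, ps, pa, pb, pc⟩ := h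
  obtain ⟨r1, r2, r3, r4, r5, rs, ra, rb, rc⟩ := h'
  have hγ : γ = c := by
    rcases mul_eq_zero.1 pa with pa | pa
    · rcases mul_eq_zero.1 ra with ra | ra
      · rw [pa, ra]
      · rcases mul_eq_zero.1 rb with rb | rb
        · rw [pa, rb]
        · linarith
    · rcases mul_eq_zero.1 pb with pb | pb
      · rcases mul_eq_zero.1 ra with ra | ra
        · rw [pb, ra]
        · rcases mul_eq_zero.1 rb with rb | rb
          · rw [pb, rb]
          · linarith
      · rcases mul_eq_zero.1 ra with ra | ra
        · linarith
        · rcases mul_eq_zero.1 rb with rb | rb <;> linarith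
  have hβ : β = b := by
    rcases mul_eq_zero.1 pc with pc | pc <;> rcases mul_eq_zero.1 rc with rc | rc <;> linarith
  refine ⟨hβ, ?_, ?_, ?_, hγ⟩ <;> linarith

theorem sectorPoint_shift (i : Fin n) (β ω γ : ℝ) :
    sectorPoint i 0 β 0 ω γ = sectorPoint (i + 1) β 0 ω 0 γ := by
  simp [sectorPoint]

theorem injOn_realize_planeVertex (hn : 3 ≤ n) :
    Set.InjOn (realize planeVertex) (realization (wheel n)) := by
  intro x hx y hy hxy
  obtain ⟨i, β, β', ω, ω', γ, h, rfl⟩ := exists_isSector hn hx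
  obtain ⟨k, b, b', w, w', c, h', rfl⟩ := exists_isSector hn hy
  rw [realize_planeVertex, realize_planeVertex] at hxy
  have hX := congrArg (fun z => z 0) hxy
  have hY := congrArg (fun z => z 1) hxy
  simp only [Matrix.cons_val_zero, Matrix.cons_val_one] at hX hY
  have ⟨p1, p2, p3, p4, p5, ps, pa, pb, pc⟩ := h
  have ⟨r1, r2, r3, r4, r5, rs, ra, rb, rc⟩ := h'
  rcases sector_unique hn (by linarith) (by linarith) (by linarith) (by linarith) hX hY with
    ⟨rfl, h1, h2⟩ | ⟨rfl, h1, h2, h3⟩ | ⟨rfl, h1, h2, h3⟩ | ⟨h1, h2, h3, h4⟩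
  · have := h.coord_eq h' h1 h2
    obtain ⟨rfl, rfl, rfl, rfl, rfl⟩ := this
    rfl
  · obtain rfl : β = 0 := by linarith
    obtain rfl : ω = 0 := by linarith
    obtain rfl : b' = 0 := by linarith
    obtain rfl : w' = 0 := by linarith
    obtain ⟨rfl, -, rfl, -, rfl⟩ := IsSector.coord_eq
      ⟨p2, le_rfl, p4, le_rfl, p5, by linarith, pb, by simp, by simp⟩ h' h3 (by simp)
    exact sectorPoint_shift i _ _ _
  · obtain rfl : β' = 0 := by linarith
    obtain rfl : ω' = 0 := by linarith
    obtain rfl : b = 0 := by linarith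
    obtain rfl : w = 0 := by linarith
    obtain ⟨rfl, -, rfl, -, rfl⟩ := IsSector.coord_eq h
      ⟨r2, le_rfl, r4, le_rfl, r5, by linarith, rb, by simp, by simp⟩ h3 (by simp)
    exact (sectorPoint_shift _ _ _ _).symm
  · obtain rfl : β = 0 := by linarith
    obtain rfl : ω = 0 := by linarith
    obtain rfl : β' = 0 := by linarith
    obtain rfl : ω' = 0 := by linarith
    obtain rfl : b = 0 := by linarith
    obtain rfl : w = 0 := by linarith
    obtain rfl : b' = 0 := by linarith
    obtain rfl : w' = 0 := by linarith
    obtain rfl : γ = c := by linarith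
    simp [sectorPoint]

theorem exists_realize_planeVertex (hn : 3 ≤ n) (u : EuclideanSpace ℝ (Fin 2))
    (hu : ∀ k : Fin n, gauge k (u 0) (u 1) ≤ 2) :
    ∃ x ∈ realization (wheel n), realize planeVertex x = u := by
  obtain ⟨i, s, t, hs, ht, hX, hY⟩ := exists_sector hn (u 0) (u 1)
  have hst : s + t ≤ 2 := by
    have := hu i
    rwa [hX, hY, gauge_sector hn] at this
  -- The inner polygon is s + t ≤ 1. Beyond it the total rim weight must be s + t − 1, and the
  -- diagonal of the collar is where this equals t / 2.
  have key : ∃ β β' ω ω' γ : ℝ, IsSector β β' ω ω' γ ∧ 2 * β + ω = s ∧ 2 * β' + ω' = t := by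
    rcases le_total (s + t) 1 with h1 | h1
    · exact ⟨0, 0, s, t, 1 - s - t, ⟨le_rfl, le_rfl, hs, ht, by linarith, by ring, by simp,
        by simp, by simp⟩, by ring, by ring⟩
    rcases le_total (s + t - 1) (t / 2) with h2 | h2
    · exact ⟨0, s + t - 1, s, t - 2 * (s + t - 1), 0, ⟨le_rfl, by linarith, hs, by linarith,
        le_rfl, by ring, by simp, by simp, by simp⟩, by ring, by ring⟩
    · exact ⟨s + t - 1 - t / 2, t / 2, 2 - (s + t), 0, 0, ⟨by linarith, by linarith, by linarith,
        le_rfl, le_rfl, by ring, by simp, by simp, by simp⟩, by ring, by ring⟩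
  obtain ⟨β, β', ω, ω', γ, h, rfl, rfl⟩ := key
  refine ⟨_, h.mem_realization (i := i), ?_⟩
  rw [realize_planeVertex, ← hX, ← hY]
  ext k
  fin_cases k <;> rfl

/-- The vertices of the large regular polygon. -/
noncomputable def ngonVertices (n : ℕ) : Finset (EuclideanSpace ℝ (Fin 2)) :=
  Finset.univ.image fun i : Fin n => !₂[2 * ngonX i, 2 * ngonY i]

theorem realize_planeVertex_mem_convexHull (hn : 3 ≤ n) {x : Vert n → ℝ}
    (hx : x ∈ realization (wheel n)) :
    realize planeVertex x ∈ convexHull ℝ (ngonVertices n : Set (EuclideanSpace ℝ (Fin 2))) := by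
  have hconv := convex_convexHull ℝ (ngonVertices n : Set (EuclideanSpace ℝ (Fin 2)))
  have hrim : ∀ i : Fin n, planeVertex (rim i) ∈
      convexHull ℝ (ngonVertices n : Set (EuclideanSpace ℝ (Fin 2))) := fun i =>
    subset_convexHull ℝ _ (Finset.mem_coe.2 (Finset.mem_image_of_mem _ (Finset.mem_univ i)))
  have hhub : planeVertex (hub : Vert n) ∈
      convexHull ℝ (ngonVertices n : Set (EuclideanSpace ℝ (Fin 2))) := by
    have hn0 : (n : ℝ) ≠ 0 := Nat.cast_ne_zero.2 (NeZero.ne n)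
    have := hconv.sum_mem (t := Finset.univ) (w := fun _ : Fin n => (1 / n : ℝ))
      (z := fun i => planeVertex (rim i)) (fun _ _ => by positivity)
      (by simp [hn0]) (fun i _ => hrim i)
    convert this
    rw [← Finset.smul_sum]
    obtain ⟨h1, h2⟩ := sum_ngon hn
    ext k
    fin_cases k <;> simp [planeVertex, ← Finset.mul_sum, h1, h2]
  refine hconv.sum_mem (fun v _ => hx.1.1 v) hx.1.2 fun v _ => ?_
  rcases v with i | i | u
  · exact hrim i
  · have := hconv (hrim i) hhub (a := 1 / 2) (b := 1 / 2) (by norm_num) (by norm_num) (by norm_num)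
    convert this
    ext k
    fin_cases k <;> simp [planeVertex]
  · exact hhub

theorem gauge_le_two_of_mem_convexHull (hn : 3 ≤ n) {u : EuclideanSpace ℝ (Fin 2)}
    (hu : u ∈ convexHull ℝ (ngonVertices n : Set (EuclideanSpace ℝ (Fin 2)))) (k : Fin n) :
    gauge k (u 0) (u 1) ≤ 2 := by
  have hconv : Convex ℝ {u : EuclideanSpace ℝ (Fin 2) | gauge k (u 0) (u 1) ≤ 2} := by
    intro u hu w hw a b ha hb hab
    simp only [Set.mem_ofPred_eq, PiLp.add_apply, PiLp.smul_apply, smul_eq_mul] at hu hw ⊢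
    rw [gauge_combination]
    nlinarith
  refine convexHull_min ?_ hconv hu
  intro w hw
  obtain ⟨j, -, rfl⟩ := Finset.mem_image.1 (Finset.mem_coe.1 hw)
  have := gauge_combination k 2 0 (ngonX j) (ngonY j) 0 0
  have h2 := gauge_ngon_le hn j k
  simp only [mul_zero, add_zero, zero_mul] at this
  simp only [Set.mem_ofPred_eq, Matrix.cons_val_zero, Matrix.cons_val_one]
  linarith

theorem isPLDisk_wheel (hn : 3 ≤ n) : IsPLDisk (wheel n) := by
  refine ⟨ngonVertices n, ?_, ?_⟩
  · have hopen : IsOpen {u : EuclideanSpace ℝ (Fin 2) | ∀ k : Fin n, gauge k (u 0) (u 1) < 2} := by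
      simp only [Set.ofPred_forall]
      refine isOpen_iInter_of_finite fun k => isOpen_lt ?_ continuous_const
      unfold gauge; fun_prop
    refine ⟨0, interior_maximal ?_ hopen ?_⟩
    · intro u hu
      obtain ⟨x, hx, rfl⟩ := exists_realize_planeVertex hn u fun k => (hu k).le
      exact realize_planeVertex_mem_convexHull hn hx
    · simp [gauge]
  · have : CompactSpace (realization (wheel n)) :=
      isCompact_iff_compactSpace.1 (isCompact_realization _)
    let g : realization (wheel n) →
        convexHull ℝ (ngonVertices n : Set (EuclideanSpace ℝ (Fin 2))) :=
      fun x => ⟨realize planeVertex x, realize_planeVertex_mem_convexHull hn x.2⟩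
    have hg : Continuous g :=
      ((continuous_realize planeVertex).comp continuous_subtype_val).subtype_mk _
    have hb : Function.Bijective g := by
      constructor
      · intro x y h
        exact Subtype.ext (injOn_realize_planeVertex hn x.2 y.2 (congrArg Subtype.val h))
      · rintro ⟨u, hu⟩
        obtain ⟨x, hx, rfl⟩ := exists_realize_planeVertex hn u
          (gauge_le_two_of_mem_convexHull hn hu)
        exact ⟨⟨x, hx⟩, rfl⟩
    refine ⟨Continuous.homeoOfEquivCompactToT2 (f := Equiv.ofBijective g hb) hg, ?_⟩
    exact isPolyhedron_range_realize (wheel n) planeVertex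

end Disk

/-! ### General position in four-space -/

section GeneralPosition

open MeasureTheory

/-- Each condition excludes an affine subspace of dimension at most three, a null set; finitely many
null sets do not cover four-space. -/
theorem exists_sub_notMem_span {S : Set (EuclideanSpace ℝ (Fin 4) × EuclideanSpace ℝ (Fin 4) ×
    EuclideanSpace ℝ (Fin 4) × EuclideanSpace ℝ (Fin 4))} (hS : S.Finite) :
    ∃ ζ : EuclideanSpace ℝ (Fin 4), ∀ t ∈ S,
      ζ - t.1 ∉ Submodule.span ℝ {t.2.1, t.2.2.1, t.2.2.2} := by
  have hnull : volume (⋃ t ∈ S, (AffineSubspace.mk' t.1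
      (Submodule.span ℝ {t.2.1, t.2.2.1, t.2.2.2}) : Set (EuclideanSpace ℝ (Fin 4)))) = 0 := by
    refine (measure_biUnion_null_iff hS.countable).2 fun t _ => ?_
    refine Measure.addHaar_affineSubspace _ _ fun h => ?_
    have hd := congrArg AffineSubspace.direction h
    rw [AffineSubspace.direction_mk', AffineSubspace.direction_top] at hd
    have h3 : Module.finrank ℝ (Submodule.span ℝ ({t.2.1, t.2.2.1, t.2.2.2} :
        Set (EuclideanSpace ℝ (Fin 4)))) ≤ 3 := by
      classical
      have := finrank_span_finset_le_card (R := ℝ)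
        ({t.2.1, t.2.2.1, t.2.2.2} : Finset (EuclideanSpace ℝ (Fin 4)))
      rw [Finset.coe_insert, Finset.coe_insert, Finset.coe_singleton] at this
      exact this.trans Finset.card_le_three
    rw [hd, finrank_top, finrank_euclideanSpace_fin] at h3
    omega
  by_contra! hcon
  have huniv : (⋃ t ∈ S, (AffineSubspace.mk' t.1 (Submodule.span ℝ {t.2.1, t.2.2.1, t.2.2.2}) :
      Set (EuclideanSpace ℝ (Fin 4)))) = Set.univ := by
    refine Set.eq_univ_of_forall fun ζ => ?_
    obtain ⟨t, ht, h⟩ := hcon ζ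
    exact Set.mem_biUnion ht ((AffineSubspace.mem_mk').2 h)
  rw [huniv] at hnull
  exact (isOpen_univ.measure_pos volume Set.univ_nonempty).ne' hnull

theorem eq_zero_of_notMem_span {E : Type*} [AddCommGroup E] [Module ℝ E] {x a b c : E}
    (h : x ∉ Submodule.span ℝ {a, b, c}) {r s t u : ℝ}
    (h0 : r • x + s • a + t • b + u • c = 0) : r = 0 := by
  by_contra hr
  apply h
  rw [Submodule.mem_span_triple]
  refine ⟨-(r⁻¹ * s), -(r⁻¹ * t), -(r⁻¹ * u), ?_⟩
  have : x = r⁻¹ • (r • x) := by rw [smul_smul, inv_mul_cancel₀ hr, one_smul]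
  rw [this, show r • x = -(s • a + t • b + u • c) by
    rw [eq_neg_iff_add_eq_zero, ← h0]; abel]
  module

variable {n : ℕ} [NeZero n]

/-- A regular polygon in the plane through `ζ` spanned by `A` and `B`. -/
noncomputable def innerVertex (A B ζ : EuclideanSpace ℝ (Fin 4)) (i : Fin n) :
    EuclideanSpace ℝ (Fin 4) :=
  ζ + (ngonX i • A + ngonY i • B)

/-- The position of the inner polygon is generic with respect to the rim `v`. -/
structure IsGeneric (v : Fin n → EuclideanSpace ℝ (Fin 4))
    (A B ζ : EuclideanSpace ℝ (Fin 4)) : Prop where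
  -- Independence is asked modulo the two edges, not together with them, because consecutive edges
  -- of the polygon may be collinear.
  plane : ∀ i (r s t u : ℝ),
    r • A + s • B + t • (v (i + 1) - v i) + u • (v (i - 1) - v i) = 0 → r = 0 ∧ s = 0
  -- Keeps the plane of the inner polygon away from the line of every edge.
  hub_notMem : ∀ i, ζ - v i ∉ Submodule.span ℝ {A, B, v (i + 1) - v i}
  -- This condition and the next let a collar triangle meet edge j only in points without inner
  -- weight.
  rimTriangle : ∀ i j, innerVertex A B ζ i - v i ∉
    Submodule.span ℝ {v (i + 1) - v i, v j - v i, v (j + 1) - v i}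
  midTriangle : ∀ i j, innerVertex A B ζ i - v (i + 1) ∉ Submodule.span ℝ
    {innerVertex A B ζ (i + 1) - innerVertex A B ζ i, v j - v (i + 1), v (j + 1) - v (i + 1)}
  -- Together with `plane`, makes the two inner directions at a rim vertex independent modulo the
  -- rim edges.
  rimStar : ∀ i, innerVertex A B ζ (i + 1) - v (i + 1) ∉ Submodule.span ℝ
    {v (i + 1 + 1) - v (i + 1), v i - v (i + 1),
      innerVertex A B ζ i - innerVertex A B ζ (i + 1)}

theorem exists_isGeneric (v : Fin n → EuclideanSpace ℝ (Fin 4)) :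
    ∃ A B ζ, IsGeneric v A B ζ := by
  obtain ⟨A, hA⟩ := exists_sub_notMem_span (Set.finite_range fun i : Fin n =>
    ((0 : EuclideanSpace ℝ (Fin 4)), v (i + 1) - v i, v (i - 1) - v i,
      (0 : EuclideanSpace ℝ (Fin 4))))
  obtain ⟨B, hB⟩ := exists_sub_notMem_span (Set.finite_range fun i : Fin n =>
    ((0 : EuclideanSpace ℝ (Fin 4)), v (i + 1) - v i, v (i - 1) - v i, A))
  -- The inner vertices are ζ + q i with q fixed before ζ. Their differences do not involve ζ, so
  -- each remaining condition only keeps ζ off a fixed affine subspace.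
  let q : Fin n → EuclideanSpace ℝ (Fin 4) := fun i => ngonX i • A + ngonY i • B
  obtain ⟨ζ, hζ⟩ := exists_sub_notMem_span
    ((((Set.finite_range fun i : Fin n => (v i, A, B, v (i + 1) - v i)).union
    (Set.finite_range fun k : Fin n × Fin n =>
      (v k.1 - q k.1, v (k.1 + 1) - v k.1, v k.2 - v k.1, v (k.2 + 1) - v k.1))).union
    (Set.finite_range fun k : Fin n × Fin n =>
      (v (k.1 + 1) - q k.1, q (k.1 + 1) - q k.1, v k.2 - v (k.1 + 1),
        v (k.2 + 1) - v (k.1 + 1)))).union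
    (Set.finite_range fun i : Fin n =>
      (v (i + 1) - q (i + 1), v (i + 1 + 1) - v (i + 1), v i - v (i + 1), q i - q (i + 1))))
  have e : ∀ i w, ζ - (w - q i) = innerVertex A B ζ i - w := fun i w => by
    simp only [innerVertex, q]; abel
  have e' : ∀ i j, q i - q j = innerVertex A B ζ i - innerVertex A B ζ j := fun i j => by
    simp only [innerVertex, q]; abel
  refine ⟨A, B, ζ, ⟨fun i r s t u h => ?_, fun i => ?_, fun i j => ?_, fun i j => ?_, fun i => ?_⟩⟩
  · have hB' := hB _ ⟨i, rfl⟩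
    have hA' := hA _ ⟨i, rfl⟩
    rw [sub_zero] at hB' hA'
    have hs : s = 0 := eq_zero_of_notMem_span hB' (s := t) (t := u) (u := r)
      (by rw [← h]; abel)
    have hr : r = 0 := eq_zero_of_notMem_span hA' (s := t) (t := u) (u := 0)
      (by rw [← h, hs]; simp)
    exact ⟨hr, hs⟩
  · exact hζ (v i, A, B, v (i + 1) - v i) (Set.mem_union_left _ (Set.mem_union_left _
      (Set.mem_union_left _ (Set.mem_range_self i))))
  · have := hζ (_, _, _, _) (Set.mem_union_left _ (Set.mem_union_left _
      (Set.mem_union_right _ (Set.mem_range_self (i, j)))))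
    rwa [e] at this
  · have := hζ (_, _, _, _) (Set.mem_union_left _ (Set.mem_union_right _
      (Set.mem_range_self (i, j))))
    simp only [e, e'] at this
    exact this
  · have := hζ (_, _, _, _) (Set.mem_union_right _ (Set.mem_range_self i))
    simp only [e, e'] at this
    exact this

/-- The vertices of a surface that spans the polygon `v`. -/
noncomputable def spaceVertex (v : Fin n → EuclideanSpace ℝ (Fin 4))
    (A B ζ : EuclideanSpace ℝ (Fin 4)) : Vert n → EuclideanSpace ℝ (Fin 4)
  | .inl i => v i
  | .inr (.inl i) => innerVertex A B ζ i
  | .inr (.inr _) => ζ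

variable {v : Fin n → EuclideanSpace ℝ (Fin 4)} {A B ζ : EuclideanSpace ℝ (Fin 4)}

theorem realize_spaceVertex (i : Fin n) (β β' ω ω' γ : ℝ) :
    realize (spaceVertex v A B ζ) (sectorPoint i β β' ω ω' γ) =
      β • v i + β' • v (i + 1) + ω • innerVertex A B ζ i + ω' • innerVertex A B ζ (i + 1) +
        γ • ζ :=
  realize_sectorPoint _ _ _ _ _ _ _

/-- Equality of the images is a linear relation in which the vector avoiding a span of three others
has as coefficient the inner weight of x, or 1 if x is in the hub cone. Genericity makes this
coefficient vanish. -/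
theorem IsGeneric.mem_boundary (hn : 3 ≤ n) (hg : IsGeneric v A B ζ) {x y : Vert n → ℝ}
    (hx : x ∈ realization (wheel n)) (hy : y ∈ boundary (wheel n))
    (h : realize (spaceVertex v A B ζ) x = realize (spaceVertex v A B ζ) y) :
    x ∈ boundary (wheel n) := by
  obtain ⟨i, β, β', ω, ω', γ, hs, rfl⟩ := exists_isSector hn hx
  obtain ⟨j, s, -, rfl⟩ := (mem_boundary_wheel hn).1 hy
  rw [realize_spaceVertex, realize_spaceVertex] at h
  simp only [zero_smul, add_zero] at h
  obtain ⟨p1, p2, p3, p4, p5, ps, pa, pb, pc⟩ := hs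
  have planar : ∀ a b : ℝ, ¬ ζ + (a • A + b • B) = (1 - s) • v j + s • v (j + 1) := by
    intro a b hab
    have := eq_zero_of_notMem_span (hg.hub_notMem j) (r := 1) (s := a) (t := b) (u := -s) (by
      exact Eq.trans (by module) (sub_eq_zero.2 hab))
    exact one_ne_zero this
  by_cases hβ : β = 0 ∧ β' = 0
  · obtain ⟨rfl, rfl⟩ := hβ
    refine absurd ?_ (planar (ω * ngonX i + ω' * ngonX (i + 1)) (ω * ngonY i + ω' * ngonY (i + 1)))
    rw [← h]
    obtain rfl : γ = 1 - ω - ω' := by linarith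
    simp only [innerVertex]
    module
  have hγ : γ = 0 := by
    by_contra hγ
    exact hβ ⟨(mul_eq_zero.1 pa).resolve_left hγ, (mul_eq_zero.1 pb).resolve_left hγ⟩
  subst hγ
  rcases mul_eq_zero.1 pc with rfl | rfl
  · have h0 := eq_zero_of_notMem_span (hg.midTriangle i j) (r := ω + ω') (s := ω') (t := -(1 - s))
      (u := -s) (by
        obtain rfl : β' = 1 - ω - ω' := by linarith
        exact Eq.trans (by module) (sub_eq_zero.2 h))
    obtain rfl : ω = 0 := by linarith
    obtain rfl : ω' = 0 := by linarith
    exact sectorPoint_mem_boundary hn p1 p2 (by linarith)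
  · have h0 := eq_zero_of_notMem_span (hg.rimTriangle i j) (r := ω) (s := β') (t := -(1 - s))
      (u := -s) (by
        obtain rfl : β = 1 - ω - β' := by linarith
        exact Eq.trans (by module) (sub_eq_zero.2 h))
    subst h0
    exact sectorPoint_mem_boundary hn p1 p2 (by linarith)

theorem IsEmbeddedPolygon.edge_eq {P : Polygon (EuclideanSpace ℝ (Fin 4)) n}
    (hP : IsEmbeddedPolygon P) {i j : Fin n} {s t : ℝ} (hs : s ∈ Set.Ico (0 : ℝ) 1)
    (ht : t ∈ Set.Ico (0 : ℝ) 1)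
    (h : (1 - s) • P i + s • P (i + 1) = (1 - t) • P j + t • P (j + 1)) : i = j ∧ s = t := by
  have := @hP (i, ⟨s, hs⟩) (j, ⟨t, ht⟩) (by
    simpa only [Polygon.edgePath, AffineMap.lineMap_apply_module, finRotate_apply] using h)
  simpa only [Prod.mk.injEq, Subtype.mk.injEq] using this

theorem injOn_boundary (hn : 3 ≤ n) (P : Polygon (EuclideanSpace ℝ (Fin 4)) n)
    (hP : IsEmbeddedPolygon P) :
    Set.InjOn (realize (spaceVertex P A B ζ)) (boundary (wheel n)) := by
  intro x hx y hy h
  obtain ⟨i, s, hs, rfl⟩ := (mem_boundary_wheel hn).1 hx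
  obtain ⟨j, t, ht, rfl⟩ := (mem_boundary_wheel hn).1 hy
  rw [realize_spaceVertex, realize_spaceVertex] at h
  simp only [zero_smul, add_zero] at h
  obtain ⟨rfl, rfl⟩ := hP.edge_eq hs ht h
  rfl

end GeneralPosition

/-! ### Straightening homeomorphisms -/

section Charts

/-- A global chart of four-space that straightens the image of the open star of a vertex. -/
theorem exists_chart_of_star {V E : Type*} [Fintype V] [AddCommGroup E] [Module ℝ E]
    [TopologicalSpace E] [ContinuousAdd E] [ContinuousSMul ℝ E] [T2Space E]
    (K : AbstractSimplicialComplex V) (p : V → E) (w : V)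
    (hinj : Set.InjOn (realize p) {x | x ∈ realization K ∧ 0 < x w}) (Φ : E ≃ₜ E) {ρ : E → ℝ}
    (hρ : Continuous ρ) (hρw : ∀ x ∈ realization K, 0 < x w → ρ (realize p x) = x w)
    {x₀ : V → ℝ} (hx₀ : x₀ ∈ realization K) (hw : 0 < x₀ w) :
    ∃ U : Set (V → ℝ), IsOpen U ∧ x₀ ∈ U ∧
      Topology.IsEmbedding ((U ∩ realization K).domRestrict (realize p)) ∧
      ∃ e : OpenPartialHomeomorph E E, realize p x₀ ∈ e.source ∧ (∀ y, e y = Φ y) ∧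
        ∀ y ∈ e.source, 0 < ρ y ∧ (y ∈ realize p '' (U ∩ realization K) ↔
          y ∈ realize p '' {x | x ∈ realization K ∧ 0 < x w}) := by
  -- Cutting surface and four-space at the same level, half the weight of x₀, makes sheet and star
  -- agree on the chart domain. The closed superlevel set is compact, which gives the embedding.
  have hopen : IsOpen {y | x₀ w / 2 < ρ y} := isOpen_lt continuous_const hρ
  refine ⟨{x | x₀ w / 2 < x w}, isOpen_lt continuous_const (continuous_apply w),
    by simp only [Set.mem_ofPred_eq]; linarith, ?_,
    Φ.toOpenPartialHomeomorphOfImageEq _ hopen _ rfl, ?_, fun y => rfl, ?_⟩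
  · let C : Set (V → ℝ) := {x | x₀ w / 2 ≤ x w} ∩ realization K
    have hC : IsCompact C :=
      (isCompact_realization K).inter_left (isClosed_le continuous_const (continuous_apply w))
    have : CompactSpace C := isCompact_iff_compactSpace.1 hC
    have hemb : Topology.IsClosedEmbedding (C.domRestrict (realize p)) := by
      refine Continuous.isClosedEmbedding ?_ ?_
      · exact (continuous_realize p).comp continuous_subtype_val
      · intro x y h
        have hx : x₀ w / 2 ≤ x.1 w := x.2.1
        have hy : x₀ w / 2 ≤ y.1 w := y.2.1
        exact Subtype.ext (hinj ⟨x.2.2, by linarith⟩ ⟨y.2.2, by linarith⟩ h)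
    have hsub : {x | x₀ w / 2 < x w} ∩ realization K ⊆ C :=
      fun x hx => ⟨(show x₀ w / 2 < x w from hx.1).le, hx.2⟩
    exact hemb.isEmbedding.comp (Topology.IsEmbedding.inclusion hsub)
  · change x₀ w / 2 < ρ (realize p x₀)
    rw [hρw x₀ hx₀ hw]; linarith
  · intro y hy
    change x₀ w / 2 < ρ y at hy
    refine ⟨by linarith, ?_⟩
    constructor
    · rintro ⟨x, ⟨hx, hxK⟩, rfl⟩
      have hx : x₀ w / 2 < x w := hx
      exact ⟨x, ⟨hxK, by linarith⟩, rfl⟩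
    · rintro ⟨x, ⟨hxK, hx⟩, rfl⟩
      rw [hρw x hxK hx] at hy
      exact ⟨x, ⟨hy, hxK⟩, rfl⟩

theorem continuous_vec4 {X : Type*} [TopologicalSpace X] {a b c d : X → ℝ} (ha : Continuous a)
    (hb : Continuous b) (hc : Continuous c) (hd : Continuous d) :
    Continuous fun x => (!₂[a x, b x, c x, d x] : EuclideanSpace ℝ (Fin 4)) := by
  refine (PiLp.continuous_toLp 2 _).comp (continuous_pi fun i => ?_)
  fin_cases i <;> assumption

theorem exists_coordinates {a b c d : EuclideanSpace ℝ (Fin 4)}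
    (h : ∀ r s t u : ℝ, r • a + s • b + t • c + u • d = 0 → r = 0 ∧ s = 0 ∧ t = 0 ∧ u = 0) :
    ∃ L : EuclideanSpace ℝ (Fin 4) ≃L[ℝ] EuclideanSpace ℝ (Fin 4),
      ∀ r s t u : ℝ, L (r • a + s • b + t • c + u • d) = !₂[r, s, t, u] := by
  let M : EuclideanSpace ℝ (Fin 4) →ₗ[ℝ] EuclideanSpace ℝ (Fin 4) :=
    { toFun := fun y => y 0 • a + y 1 • b + y 2 • c + y 3 • d
      map_add' := fun x y => by simp only [PiLp.add_apply]; module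
      map_smul' := fun r x => by
        simp only [PiLp.smul_apply, smul_eq_mul, RingHom.id_apply]; module }
  have hM : Function.Injective M := by
    rw [← LinearMap.ker_eq_bot, LinearMap.ker_eq_bot']
    intro y hy
    obtain ⟨h0, h1, h2, h3⟩ := h _ _ _ _ hy
    ext i
    fin_cases i <;> assumption
  refine ⟨(LinearEquiv.ofInjectiveEndo M hM).toContinuousLinearEquiv.symm, fun r s t u => ?_⟩
  rw [ContinuousLinearEquiv.symm_apply_eq]
  rfl

/-- A homeomorphism that straightens the product of two corners. -/
noncomputable def cornerHomeomorph :
    EuclideanSpace ℝ (Fin 4) ≃ₜ EuclideanSpace ℝ (Fin 4) where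
  -- A pair (a, b) is recovered from a − b and min a b, and the corner is min a b = 0.
  toFun y := !₂[y 0 - y 2, y 1 - y 3, min (y 0) (y 2), min (y 1) (y 3)]
  invFun z := !₂[z 2 + max (z 0) 0, z 3 + max (z 1) 0, z 2 + max (-z 0) 0, z 3 + max (-z 1) 0]
  left_inv y := by
    ext i
    fin_cases i <;> simp <;> grind
  right_inv z := by
    ext i
    fin_cases i <;> simp <;> grind
  continuous_toFun := by
    apply continuous_vec4 <;> fun_prop
  continuous_invFun := by
    apply continuous_vec4 <;> fun_prop

/-- A homeomorphism that straightens three consecutive sectors to a half-plane. -/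
noncomputable def halfHomeomorph (κ : ℝ) :
    EuclideanSpace ℝ (Fin 4) ≃ₜ EuclideanSpace ℝ (Fin 4) where
  -- The first two entries h, k parametrize the half-plane h ≥ 0. On the three sectors y 2 is 0, (h
  -- − k) / 2 and h, that is, (h − k) / 2 clamped to [0, h]. The last entry is a shear that acts
  -- only where y 0 < 0.
  toFun y := !₂[y 1 + y 2, y 0 + y 1 - y 2,
    y 2 - max 0 (min (y 1 + y 2) (((y 1 + y 2) - (y 0 + y 1 - y 2)) / 2)),
    y 3 - κ * max 0 (-y 0)]
  invFun z := !₂[z 1 - z 0 + 2 * (z 2 + max 0 (min (z 0) ((z 0 - z 1) / 2))),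
    z 0 - (z 2 + max 0 (min (z 0) ((z 0 - z 1) / 2))),
    z 2 + max 0 (min (z 0) ((z 0 - z 1) / 2)),
    z 3 + κ * max 0 (-(z 1 - z 0 + 2 * (z 2 + max 0 (min (z 0) ((z 0 - z 1) / 2)))))]
  left_inv y := by
    ext i
    fin_cases i <;> simp <;> ring_nf
  right_inv z := by
    ext i
    fin_cases i <;> simp <;> ring_nf
  continuous_toFun := by
    apply continuous_vec4 <;> fun_prop
  continuous_invFun := by
    apply continuous_vec4 <;> fun_prop

theorem nonneg_of_min_eq_zero {a b : ℝ} (h : min a b = 0) : 0 ≤ a ∧ 0 ≤ b ∧ a * b = 0 := by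
  refine ⟨h ▸ min_le_left a b, h ▸ min_le_right a b, ?_⟩
  rcases min_choice a b with h' | h' <;> rw [← h', h] <;> simp

theorem min_eq_zero_of_mul_eq_zero {a b : ℝ} (ha : 0 ≤ a) (hb : 0 ≤ b) (h : a * b = 0) :
    min a b = 0 := by
  rcases mul_eq_zero.1 h with rfl | rfl
  exacts [min_eq_left hb, min_eq_right ha]

end Charts

/-! ### Stars of the inner vertices -/

section Stars

open Real

variable {n : ℕ} [NeZero n]

theorem mid_star (hn : 3 ≤ n) (j : Fin n) {x : Vert n → ℝ} (hx : x ∈ realization (wheel n))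
    (hpos : 0 < x (mid (j + 1))) :
    (∃ β β' ω ω' γ, IsSector β β' ω ω' γ ∧ x = sectorPoint (j + 1) β β' ω ω' γ) ∨
      ∃ β' ω ω' γ, IsSector 0 β' ω ω' γ ∧ x = sectorPoint j 0 β' ω ω' γ := by
  obtain ⟨i, β, β', ω, ω', γ, hs, rfl⟩ := exists_isSector hn hx
  by_cases h1 : j + 1 = i
  · subst h1
    exact .inl ⟨_, _, _, _, _, hs, rfl⟩
  by_cases h2 : j = i
  · subst h2
    rw [sectorPoint_mid_succ hn] at hpos
    obtain rfl : β = 0 := (mul_eq_zero.1 hs.diag).resolve_right hpos.ne'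
    exact .inr ⟨_, _, _, _, hs, rfl⟩
  · rw [sectorPoint_mid_of_ne _ _ _ _ _ _ _ h1 fun h => h2 (add_right_cancel h)] at hpos
    exact absurd hpos (lt_irrefl _)

theorem rim_star (hn : 3 ≤ n) (j : Fin n) {x : Vert n → ℝ} (hx : x ∈ realization (wheel n))
    (hpos : 0 < x (rim (j + 1))) :
    (∃ β β' ω, IsSector β β' ω 0 0 ∧ x = sectorPoint (j + 1) β β' ω 0 0) ∨
      ∃ β β' ω ω', IsSector β β' ω ω' 0 ∧ x = sectorPoint j β β' ω ω' 0 := by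
  obtain ⟨i, β, β', ω, ω', γ, hs, rfl⟩ := exists_isSector hn hx
  by_cases h1 : j + 1 = i
  · subst h1
    rw [sectorPoint_rim hn] at hpos
    obtain rfl : ω' = 0 := (mul_eq_zero.1 hs.diag).resolve_left hpos.ne'
    obtain rfl : γ = 0 := (mul_eq_zero.1 hs.hub_rim).resolve_right hpos.ne'
    exact .inl ⟨_, _, _, hs, rfl⟩
  by_cases h2 : j = i
  · subst h2
    rw [sectorPoint_rim_succ hn] at hpos
    obtain rfl : γ = 0 := (mul_eq_zero.1 hs.hub_rim').resolve_right hpos.ne'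
    exact .inr ⟨_, _, _, _, hs, rfl⟩
  · rw [sectorPoint_rim_of_ne _ _ _ _ _ _ _ h1 fun h => h2 (add_right_cancel h)] at hpos
    exact absurd hpos (lt_irrefl _)

theorem hub_star (hn : 3 ≤ n) {x : Vert n → ℝ} (hx : x ∈ realization (wheel n))
    (hpos : 0 < x hub) :
    ∃ i ω ω' γ, IsSector 0 0 ω ω' γ ∧ x = sectorPoint i 0 0 ω ω' γ := by
  obtain ⟨i, β, β', ω, ω', γ, hs, rfl⟩ := exists_isSector hn hx
  rw [sectorPoint_hub] at hpos
  obtain rfl : β = 0 := (mul_eq_zero.1 hs.hub_rim).resolve_left hpos.ne'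
  obtain rfl : β' = 0 := (mul_eq_zero.1 hs.hub_rim').resolve_left hpos.ne'
  exact ⟨_, _, _, _, hs, rfl⟩

variable {v : Fin n → EuclideanSpace ℝ (Fin 4)} {A B ζ : EuclideanSpace ℝ (Fin 4)}

/-- The barycentric coordinates of a point in the star of `mid (j + 1)`, in terms of its
coordinates in four-space. -/
noncomputable def midDecode (j : Fin n) (α : ℝ) (y : EuclideanSpace ℝ (Fin 4)) : Vert n → ℝ :=
  -- The hub has coordinates (α, α, 0, 0), so the minimum of the first two coordinates is α times
  -- the hub weight.
  Pi.single (mid (j + 1 + 1)) (y 0 - min (y 0) (y 1)) + Pi.single (mid j) (y 1 - min (y 0) (y 1)) +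
    Pi.single (rim (j + 1)) (y 2) + Pi.single (rim (j + 1 + 1)) (y 3) +
    Pi.single hub (min (y 0) (y 1) / α) + Pi.single (mid (j + 1))
      (1 - (y 0 + y 1 - 2 * min (y 0) (y 1)) - y 2 - y 3 - min (y 0) (y 1) / α)

theorem midDecode_of_le (j : Fin n) (α : ℝ) (y : EuclideanSpace ℝ (Fin 4)) (h : y 1 ≤ y 0) :
    midDecode j α y = sectorPoint (j + 1) (y 2) (y 3)
      (1 - (y 0 - y 1) - y 2 - y 3 - y 1 / α) (y 0 - y 1) (y 1 / α) := by
  rw [midDecode, min_eq_right h, sub_self, Pi.single_zero, sectorPoint]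
  rw [show 1 - (y 0 + y 1 - 2 * y 1) - y 2 - y 3 - y 1 / α =
    1 - (y 0 - y 1) - y 2 - y 3 - y 1 / α by ring]
  abel

theorem midDecode_of_ge (j : Fin n) (α : ℝ) (y : EuclideanSpace ℝ (Fin 4)) (h : y 0 ≤ y 1)
    (h3 : y 3 = 0) : midDecode j α y = sectorPoint j 0 (y 2) (y 1 - y 0)
      (1 - (y 1 - y 0) - y 2 - y 0 / α) (y 0 / α) := by
  rw [midDecode, min_eq_left h, sub_self, Pi.single_zero, sectorPoint, h3, Pi.single_zero,
    Pi.single_zero]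
  rw [show 1 - (y 0 + y 1 - 2 * y 0) - y 2 - 0 - y 0 / α =
    1 - (y 1 - y 0) - y 2 - y 0 / α by ring]
  abel

/-- The two neighbours of a vertex of the regular polygon add up to 2 cos(2π/n) times that vertex.
Hence the ray to the centre lies between the two inner edges, which reduces five rays to four. -/
theorem hub_sub_innerVertex (hn : 3 ≤ n) (j : Fin n) :
    ζ - innerVertex A B ζ (j + 1) = (1 / (2 - 2 * cos (2 * π / n))) •
      ((innerVertex A B ζ (j + 1 + 1) - innerVertex A B ζ (j + 1)) +
        (innerVertex A B ζ j - innerVertex A B ζ (j + 1))) := by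
  have hc : 2 - 2 * cos (2 * π / n) ≠ 0 := by linarith [cos_angle_lt_one hn]
  have hx : ngonX (j + 1 + 1) = 2 * cos (2 * π / n) * ngonX (j + 1) - ngonX j := by
    linarith [ngonX_recurrence hn j]
  have hy : ngonY (j + 1 + 1) = 2 * cos (2 * π / n) * ngonY (j + 1) - ngonY j := by
    linarith [ngonY_recurrence hn j]
  rw [one_div, eq_inv_smul_iff₀ hc]
  simp only [innerVertex, hx, hy]
  module

/-- `hub_notMem` gives t + u = 0, so the rim directions contribute only a multiple of a rim edge.
`plane` separates it from the inner directions, and two consecutive edges of a regular polygon are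
independent. -/
theorem IsGeneric.mid_independent (hn : 3 ≤ n) (hg : IsGeneric v A B ζ)
    (hv : ∀ i, v (i + 1) ≠ v i) (j : Fin n) (r s t u : ℝ)
    (h : r • (innerVertex A B ζ (j + 1 + 1) - innerVertex A B ζ (j + 1)) +
      s • (innerVertex A B ζ j - innerVertex A B ζ (j + 1)) +
      t • (v (j + 1) - innerVertex A B ζ (j + 1)) +
      u • (v (j + 1 + 1) - innerVertex A B ζ (j + 1)) = 0) : r = 0 ∧ s = 0 ∧ t = 0 ∧ u = 0 := by
  have htu : -(t + u) = 0 := eq_zero_of_notMem_span (hg.hub_notMem (j + 1))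
    (s := r * (ngonX (j + 1 + 1) - ngonX (j + 1)) + s * (ngonX j - ngonX (j + 1)) -
      (t + u) * ngonX (j + 1))
    (t := r * (ngonY (j + 1 + 1) - ngonY (j + 1)) + s * (ngonY j - ngonY (j + 1)) -
      (t + u) * ngonY (j + 1)) (u := u) (by
    rw [← h]; simp only [innerVertex]; module)
  obtain rfl : t = -u := by linarith
  obtain ⟨hX, hY⟩ := hg.plane (j + 1)
    (r * (ngonX (j + 1 + 1) - ngonX (j + 1)) + s * (ngonX j - ngonX (j + 1)))
    (r * (ngonY (j + 1 + 1) - ngonY (j + 1)) + s * (ngonY j - ngonY (j + 1))) u 0 (by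
    rw [← h]; simp only [innerVertex]; module)
  have hS := (sin_angle_pos hn).ne'
  have d := det_ngon hn j
  have d' := det_ngon hn (j + 1)
  have hrs : (r - s) * sin (2 * π / n) = 0 := by
    linear_combination ngonX (j + 1) * hY - ngonY (j + 1) * hX - r * d' + s * d
  obtain rfl : r = s := by
    have := (mul_eq_zero.1 hrs).resolve_right hS; linarith
  have hc : 2 * cos (2 * π / n) - 2 ≠ 0 := by linarith [cos_angle_lt_one hn]
  have hr : r * (2 * cos (2 * π / n) - 2) = 0 := by
    have e1 : r * (2 * cos (2 * π / n) - 2) * ngonX (j + 1) = 0 := by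
      linear_combination hX - r * ngonX_recurrence hn j
    have e2 : r * (2 * cos (2 * π / n) - 2) * ngonY (j + 1) = 0 := by
      linear_combination hY - r * ngonY_recurrence hn j
    linear_combination ngonX (j + 1) * e1 + ngonY (j + 1) * e2 -
      (r * (2 * cos (2 * π / n) - 2)) * ngon_sq (j + 1)
  obtain rfl : r = 0 := (mul_eq_zero.1 hr).resolve_right hc
  have hu : u • (v (j + 1 + 1) - v (j + 1)) = 0 := by
    rw [← h]; module
  obtain rfl : u = 0 := (smul_eq_zero.1 hu).resolve_right (sub_ne_zero.2 (hv _))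
  simp

/-- With the four edge directions as axes, the star is the cone over the cycle 0, 1, 2, 3 of axes.
The non-adjacent pairs are {0, 2} and {1, 3}, so the cone is min (y 0) (y 2) = min (y 1) (y 3) = 0.
Decoding the weights by one continuous formula yields both injectivity and ρ. -/
theorem IsGeneric.exists_chart_mid (hn : 3 ≤ n) (hg : IsGeneric v A B ζ)
    (hv : ∀ i, v (i + 1) ≠ v i) (j : Fin n) :
    ∃ (Φ : EuclideanSpace ℝ (Fin 4) ≃ₜ EuclideanSpace ℝ (Fin 4))
      (ρ : EuclideanSpace ℝ (Fin 4) → ℝ), Continuous ρ ∧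
      (∀ x ∈ realization (wheel n), 0 < x (mid (j + 1)) →
        ρ (realize (spaceVertex v A B ζ) x) = x (mid (j + 1))) ∧
      Set.InjOn (realize (spaceVertex v A B ζ))
        {x | x ∈ realization (wheel n) ∧ 0 < x (mid (j + 1))} ∧
      ∀ y, 0 < ρ y → (y ∈ realize (spaceVertex v A B ζ) ''
        {x | x ∈ realization (wheel n) ∧ 0 < x (mid (j + 1))} ↔ Φ y 2 = 0 ∧ Φ y 3 = 0) := by
  obtain ⟨L, hL⟩ := exists_coordinates (hg.mid_independent hn hv j)
  obtain ⟨α, hα, hhub⟩ : ∃ α : ℝ, 0 < α ∧ ζ - innerVertex A B ζ (j + 1) =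
      α • ((innerVertex A B ζ (j + 1 + 1) - innerVertex A B ζ (j + 1)) +
        (innerVertex A B ζ j - innerVertex A B ζ (j + 1))) :=
    ⟨_, one_div_pos.2 (by linarith [cos_angle_lt_one hn]), hub_sub_innerVertex hn j⟩
  obtain ⟨m, hm⟩ : ∃ m, m = innerVertex A B ζ (j + 1) := ⟨_, rfl⟩
  rw [← hm] at hL hhub
  have hcoord₁ : ∀ β β' ω ω' γ : ℝ, β + β' + ω + ω' + γ = 1 →
      L (realize (spaceVertex v A B ζ) (sectorPoint (j + 1) β β' ω ω' γ) - m) =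
        !₂[ω' + α * γ, α * γ, β, β'] := by
    intro β β' ω ω' γ hs
    rw [← hL, realize_spaceVertex, ← hm]
    congr 1
    obtain rfl : ω = 1 - β - β' - ω' - γ := by linarith
    rw [← sub_eq_zero]
    exact Eq.trans (b := γ • ((ζ - m) - α • ((innerVertex A B ζ (j + 1 + 1) - m) +
      (innerVertex A B ζ j - m)))) (by module) (by rw [hhub, sub_self, smul_zero])
  have hcoord₂ : ∀ β' ω ω' γ : ℝ, 0 + β' + ω + ω' + γ = 1 →
      L (realize (spaceVertex v A B ζ) (sectorPoint j 0 β' ω ω' γ) - m) =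
        !₂[α * γ, ω + α * γ, β', 0] := by
    intro β' ω ω' γ hs
    rw [← hL, realize_spaceVertex, ← hm]
    congr 1
    obtain rfl : ω' = 1 - β' - ω - γ := by linarith
    rw [← sub_eq_zero]
    exact Eq.trans (b := γ • ((ζ - m) - α • ((innerVertex A B ζ (j + 1 + 1) - m) +
      (innerVertex A B ζ j - m)))) (by module) (by rw [hhub, sub_self, smul_zero])
  have hdecode : ∀ x ∈ realization (wheel n), 0 < x (mid (j + 1)) →
      midDecode j α (L (realize (spaceVertex v A B ζ) x - m)) = x := by
    intro x hx hpos
    rcases mid_star hn j hx hpos with ⟨β, β', ω, ω', γ, hs, rfl⟩ | ⟨β', ω, ω', γ, hs, rfl⟩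
    · rw [hcoord₁ _ _ _ _ _ hs.sum_eq, midDecode_of_le _ _ _ (by simpa using hs.nonneg₄)]
      have := hs.sum_eq
      congr 1 <;> simp <;> field_simp <;> linarith
    · have hsum := hs.sum_eq
      rw [hcoord₂ _ _ _ _ hsum, midDecode_of_ge _ _ _ (by simpa using hs.nonneg₃) (by simp)]
      congr 1 <;> simp <;> field_simp <;> linarith
  refine ⟨((Homeomorph.subRight m).trans L.toHomeomorph).trans cornerHomeomorph,
    fun y => 1 - (L (y - m) 0 + L (y - m) 1 - 2 * min (L (y - m) 0) (L (y - m) 1)) - L (y - m) 2 -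
      L (y - m) 3 - min (L (y - m) 0) (L (y - m) 1) / α, by fun_prop, ?_, ?_, ?_⟩
  · intro x hx hpos
    conv_rhs => rw [← hdecode x hx hpos]
    simp [midDecode, add_one_ne hn, (add_one_ne hn _).symm]
  · rintro x ⟨hx, hx'⟩ y ⟨hy, hy'⟩ h
    rw [← hdecode x hx hx', h, hdecode y hy hy']
  · intro y hy
    change _ ↔ min (L (y - m) 0) (L (y - m) 2) = 0 ∧ min (L (y - m) 1) (L (y - m) 3) = 0
    constructor
    · rintro ⟨x, ⟨hx, hpos⟩, rfl⟩
      rcases mid_star hn j hx hpos with ⟨β, β', ω, ω', γ, hs, rfl⟩ | ⟨β', ω, ω', γ, hs, rfl⟩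
      · rw [hcoord₁ _ _ _ _ _ hs.sum_eq]
        obtain ⟨p1, p2, p3, p4, p5, ps, pa, pb, pc⟩ := hs
        exact ⟨min_eq_zero_of_mul_eq_zero (add_nonneg p4 (mul_nonneg hα.le p5)) p1
          (show (ω' + α * γ) * β = 0 by linear_combination pc + α * pa),
          min_eq_zero_of_mul_eq_zero (mul_nonneg hα.le p5) p2
          (show α * γ * β' = 0 by linear_combination α * pb)⟩
      · obtain ⟨p1, p2, p3, p4, p5, ps, pa, pb, pc⟩ := hs
        rw [hcoord₂ _ _ _ _ ps]
        exact ⟨min_eq_zero_of_mul_eq_zero (mul_nonneg hα.le p5) p2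
          (show α * γ * β' = 0 by linear_combination α * pb),
          min_eq_zero_of_mul_eq_zero (add_nonneg p3 (mul_nonneg hα.le p5)) le_rfl (by simp)⟩
    · rintro ⟨h02, h13⟩
      obtain ⟨q0, q2, q02⟩ := nonneg_of_min_eq_zero h02
      obtain ⟨q1, q3, q13⟩ := nonneg_of_min_eq_zero h13
      have hα0 := hα.ne'
      beta_reduce at hy
      -- The hub ray, where the first two coordinates agree, separates sector j + 1 from sector j.
      rcases le_or_gt (L (y - m) 1) (L (y - m) 0) with hle | hlt
      · rw [min_eq_right hle] at hy
        have hz : L (y - m) 1 * L (y - m) 2 = 0 := by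
          rcases mul_eq_zero.1 q02 with h | h
          · rw [show L (y - m) 1 = 0 by linarith, zero_mul]
          · rw [h, mul_zero]
        have hsec : IsSector (L (y - m) 2) (L (y - m) 3)
            (1 - (L (y - m) 0 - L (y - m) 1) - L (y - m) 2 - L (y - m) 3 - L (y - m) 1 / α)
            (L (y - m) 0 - L (y - m) 1) (L (y - m) 1 / α) := by
          refine ⟨q2, q3, by linarith, by linarith, by positivity, by ring, ?_, ?_, ?_⟩
          · rw [div_mul_eq_mul_div, hz, zero_div]
          · rw [div_mul_eq_mul_div, q13, zero_div]
          · linear_combination q02 - hz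
        refine ⟨_, ⟨hsec.mem_realization (i := j + 1), ?_⟩, ?_⟩
        · rw [sectorPoint_mid hn]; linarith
        · have := hcoord₁ _ _ _ _ _ hsec.sum_eq
          rw [← sub_left_inj (a := m)]
          apply L.injective
          rw [this]
          ext k
          fin_cases k <;> simp [-map_sub] <;> field_simp <;> ring
      · rw [min_eq_left hlt.le] at hy
        have h3 : L (y - m) 3 = 0 := (mul_eq_zero.1 q13).resolve_left (by linarith)
        have hsec : IsSector 0 (L (y - m) 2) (L (y - m) 1 - L (y - m) 0)
            (1 - (L (y - m) 1 - L (y - m) 0) - L (y - m) 2 - L (y - m) 0 / α)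
            (L (y - m) 0 / α) := by
          refine ⟨le_rfl, q2, by linarith, by linarith, by positivity, by ring, by simp, ?_,
            by simp⟩
          rw [div_mul_eq_mul_div, q02, zero_div]
        refine ⟨_, ⟨hsec.mem_realization (i := j), ?_⟩, ?_⟩
        · rw [sectorPoint_mid_succ hn]; linarith
        · have := hcoord₂ _ _ _ _ hsec.sum_eq
          rw [← sub_left_inj (a := m)]
          apply L.injective
          rw [this]
          ext k
          have e : α * (L (y - m) 0 / α) = L (y - m) 0 := by field_simp
          fin_cases k <;> simp [-map_sub, h3, e]

end Stars

/-! ### Stars of the rim vertices and of the hub -/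

section RimAndHub

open Real

variable {n : ℕ} [NeZero n] {v : Fin n → EuclideanSpace ℝ (Fin 4)}
  {A B ζ : EuclideanSpace ℝ (Fin 4)}

/-- The clamped quantity is c − a / 2, so c equals its clamp only on one of the three sectors: c = 0
≤ a, or a = 0, or b = 0 with a ≤ 0. -/
theorem clamp_cases {a b c : ℝ} (h : c - max 0 (min (b + c) ((b + c - (a + b - c)) / 2)) = 0)
    (h0 : 0 ≤ b + c) : 0 ≤ c ∧ (0 < a → c = 0) ∧ (a ≤ 0 → 0 ≤ b ∧ a * b = 0) := by
  rw [show (b + c - (a + b - c)) / 2 = c - a / 2 by ring] at h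
  refine ⟨by grind, by grind, fun ha => ⟨by grind, ?_⟩⟩
  have : a = 0 ∨ b = 0 := by grind
  exact mul_eq_zero.2 this

/-- Coordinates adapted to the star of a rim vertex. The two rim edges are either linearly
independent, or point into opposite directions. -/
theorem IsGeneric.exists_rim_coordinates (hn : 3 ≤ n) (hg : IsGeneric v A B ζ) (j : Fin n)
    (ha : v (j + 1 + 1) - v (j + 1) ≠ 0)
    (had : (∀ r s : ℝ, r • (v (j + 1 + 1) - v (j + 1)) + s • (v j - v (j + 1)) = 0 →
      r = 0 ∧ s = 0) ∨ ∃ κ : ℝ, 0 < κ ∧ v j - v (j + 1) = -κ • (v (j + 1 + 1) - v (j + 1))) :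
    ∃ (κ μ : ℝ) (L : EuclideanSpace ℝ (Fin 4) ≃L[ℝ] EuclideanSpace ℝ (Fin 4)), 0 < κ ∧
      ∀ r s t u : ℝ, L (r • (v (j + 1 + 1) - v (j + 1)) +
        s • (innerVertex A B ζ (j + 1) - v (j + 1)) + t • (innerVertex A B ζ j - v (j + 1)) +
        u • (v j - v (j + 1))) = !₂[r - κ * u, s, t, μ * u] := by
  have hbc : ∀ r s t u : ℝ, r • (v (j + 1 + 1) - v (j + 1)) +
      s • (innerVertex A B ζ (j + 1) - v (j + 1)) + t • (innerVertex A B ζ j - v (j + 1)) +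
      u • (v j - v (j + 1)) = 0 → s = 0 ∧ t = 0 := by
    intro r s t u h
    have hst : s + t = 0 := eq_zero_of_notMem_span (hg.rimStar j) (s := r) (t := u) (u := t) (by
      rw [← h]; module)
    obtain rfl : s = -t := by linarith
    obtain ⟨hX, hY⟩ := hg.plane (j + 1) (t * (ngonX j - ngonX (j + 1)))
      (t * (ngonY j - ngonY (j + 1))) r u (by
        rw [← h, add_sub_cancel_right]; simp only [innerVertex]; module)
    have : t * sin (2 * π / n) = 0 := by
      linear_combination ngonY (j + 1) * hX - ngonX (j + 1) * hY - t * det_ngon hn j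
    obtain rfl : t = 0 := (mul_eq_zero.1 this).resolve_right (sin_angle_pos hn).ne'
    simp
  generalize v (j + 1 + 1) - v (j + 1) = a at *
  generalize innerVertex A B ζ (j + 1) - v (j + 1) = b at *
  generalize innerVertex A B ζ j - v (j + 1) = c at *
  generalize v j - v (j + 1) = d at *
  rcases had with had | ⟨κ, hκ, rfl⟩
  -- With d + a as fourth basis vector, d has first coordinate −1, so this case takes the shape of
  -- the opposite one with κ = 1.
  · obtain ⟨L, hL⟩ := exists_coordinates (a := a) (b := b) (c := c) (d := d + a) (by
      intro r s t u h
      obtain ⟨rfl, rfl⟩ := hbc (r + u) s t u (by rw [← h]; module)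
      obtain ⟨h1, h2⟩ := had (r + u) u (by rw [← h]; module)
      exact ⟨by linarith, rfl, rfl, h2⟩)
    refine ⟨1, 1, L, one_pos, fun r s t u => ?_⟩
    simp only [one_mul, ← hL]
    congr 1
    module
  -- For opposite edges the star spans only three dimensions. Any further direction completes the
  -- basis, and μ = 0.
  · obtain ⟨d, hd⟩ := exists_sub_notMem_span
      (Set.finite_singleton ((0 : EuclideanSpace ℝ (Fin 4)), a, b, c))
    have hd := hd _ rfl
    rw [sub_zero] at hd
    obtain ⟨L, hL⟩ := exists_coordinates (a := a) (b := b) (c := c) (d := d) (by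
      intro r s t u h
      obtain rfl : u = 0 := eq_zero_of_notMem_span hd (s := r) (t := s) (u := t) (by
        rw [← h]; abel)
      obtain ⟨rfl, rfl⟩ := hbc r s t 0 (by rw [← h]; module)
      exact ⟨(smul_eq_zero.1 (show r • a = 0 by rw [← h]; module)).resolve_right ha, rfl, rfl, rfl⟩)
    refine ⟨κ, 0, L, hκ, fun r s t u => ?_⟩
    rw [zero_mul, ← hL]
    congr 1
    module

/-- The barycentric coordinates of a point in the star of `rim (j + 1)`, in terms of its
coordinates in four-space. -/
noncomputable def rimDecode (j : Fin n) (κ : ℝ) (y : EuclideanSpace ℝ (Fin 4)) : Vert n → ℝ :=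
  Pi.single (rim (j + 1 + 1)) (max 0 (y 0)) + Pi.single (mid (j + 1)) (y 1) +
    Pi.single (mid j) (y 2) + Pi.single (rim j) (max 0 (-y 0) / κ) +
    Pi.single (rim (j + 1)) (1 - max 0 (y 0) - y 1 - y 2 - max 0 (-y 0) / κ)

theorem rimDecode_of_nonneg (j : Fin n) (κ : ℝ) (y : EuclideanSpace ℝ (Fin 4)) (h : 0 ≤ y 0)
    (h2 : y 2 = 0) : rimDecode j κ y =
      sectorPoint (j + 1) (1 - y 0 - y 1) (y 0) (y 1) 0 0 := by
  rw [rimDecode, max_eq_right h, max_eq_left (by linarith), h2, zero_div, sub_zero, sub_zero,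
    Pi.single_zero, Pi.single_zero, sectorPoint, Pi.single_zero, Pi.single_zero]
  abel

theorem rimDecode_of_nonpos (j : Fin n) (κ : ℝ) (y : EuclideanSpace ℝ (Fin 4)) (h : y 0 ≤ 0) :
    rimDecode j κ y = sectorPoint j (-y 0 / κ) (1 - y 1 - y 2 - -y 0 / κ) (y 2) (y 1) 0 := by
  rw [rimDecode, max_eq_left h, max_eq_right (by linarith), sub_zero,
    Pi.single_zero, sectorPoint, Pi.single_zero]
  abel

theorem mid_eq_zero_of_mem_boundary (hn : 3 ≤ n) {x : Vert n → ℝ} (hx : x ∈ boundary (wheel n))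
    (i : Fin n) : x (mid i) = 0 := by
  obtain ⟨j, s, -, rfl⟩ := (mem_boundary_wheel hn).1 hx
  simp [sectorPoint]

theorem hub_eq_zero_of_mem_boundary (hn : 3 ≤ n) {x : Vert n → ℝ} (hx : x ∈ boundary (wheel n)) :
    x hub = 0 := by
  obtain ⟨j, s, -, rfl⟩ := (mem_boundary_wheel hn).1 hx
  simp [sectorPoint]

/-- The star is a cone over the path of rays e₀, e₁, e₂, −κ e₀ + μ e₃. The shear with factor μ / κ
removes the e₃ part, and what remains is a clamp graph. Boundary points have no inner weight, so
they lie over the line where the first chart coordinate is 0. -/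
theorem IsGeneric.exists_chart_rim (hn : 3 ≤ n) (hg : IsGeneric v A B ζ) (j : Fin n)
    (ha : v (j + 1 + 1) - v (j + 1) ≠ 0)
    (had : (∀ r s : ℝ, r • (v (j + 1 + 1) - v (j + 1)) + s • (v j - v (j + 1)) = 0 →
      r = 0 ∧ s = 0) ∨ ∃ κ : ℝ, 0 < κ ∧ v j - v (j + 1) = -κ • (v (j + 1 + 1) - v (j + 1))) :
    ∃ (Φ : EuclideanSpace ℝ (Fin 4) ≃ₜ EuclideanSpace ℝ (Fin 4))
      (ρ : EuclideanSpace ℝ (Fin 4) → ℝ), Continuous ρ ∧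
      (∀ x ∈ realization (wheel n), 0 < x (rim (j + 1)) →
        ρ (realize (spaceVertex v A B ζ) x) = x (rim (j + 1))) ∧
      Set.InjOn (realize (spaceVertex v A B ζ))
        {x | x ∈ realization (wheel n) ∧ 0 < x (rim (j + 1))} ∧
      (∀ x ∈ realization (wheel n), 0 < x (rim (j + 1)) → x ∈ boundary (wheel n) →
        Φ (realize (spaceVertex v A B ζ) x) 0 = 0) ∧
      ∀ y, 0 < ρ y → (y ∈ realize (spaceVertex v A B ζ) ''
        {x | x ∈ realization (wheel n) ∧ 0 < x (rim (j + 1))} ↔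
          Φ y 2 = 0 ∧ Φ y 3 = 0 ∧ 0 ≤ Φ y 0) := by
  obtain ⟨κ, μ, L, hκ, hL⟩ := hg.exists_rim_coordinates hn j ha had
  have hκ0 := hκ.ne'
  have hcoord₁ : ∀ β β' ω : ℝ, β + β' + ω + 0 + 0 = 1 →
      L (realize (spaceVertex v A B ζ) (sectorPoint (j + 1) β β' ω 0 0) - v (j + 1)) =
        !₂[β', ω, 0, 0] := by
    intro β β' ω hs
    have := hL β' ω 0 0
    rw [mul_zero, mul_zero, sub_zero] at this
    rw [← this, realize_spaceVertex]
    congr 1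
    obtain rfl : β = 1 - β' - ω := by linarith
    module
  have hcoord₂ : ∀ β β' ω ω' : ℝ, β + β' + ω + ω' + 0 = 1 →
      L (realize (spaceVertex v A B ζ) (sectorPoint j β β' ω ω' 0) - v (j + 1)) =
        !₂[-(κ * β), ω', ω, μ * β] := by
    intro β β' ω ω' hs
    have := hL 0 ω' ω β
    rw [zero_sub] at this
    rw [← this, realize_spaceVertex]
    congr 1
    obtain rfl : β' = 1 - β - ω - ω' := by linarith
    module
  have hdecode : ∀ x ∈ realization (wheel n), 0 < x (rim (j + 1)) →
      rimDecode j κ (L (realize (spaceVertex v A B ζ) x - v (j + 1))) = x := by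
    intro x hx hpos
    rcases rim_star hn j hx hpos with ⟨β, β', ω, hs, rfl⟩ | ⟨β, β', ω, ω', hs, rfl⟩
    · have hsum := hs.sum_eq
      rw [hcoord₁ _ _ _ hsum, rimDecode_of_nonneg _ _ _ hs.nonneg₂ rfl]
      congr 1
      simp; linarith
    · have hsum := hs.sum_eq
      rw [hcoord₂ _ _ _ _ hsum, rimDecode_of_nonpos _ _ _
        (neg_nonpos.2 (mul_nonneg hκ.le hs.nonneg₁))]
      congr 1 <;> simp <;> field_simp
      linarith
  refine ⟨((Homeomorph.subRight (v (j + 1))).trans L.toHomeomorph).trans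
      (halfHomeomorph (μ / κ)),
    fun y => 1 - max 0 (L (y - v (j + 1)) 0) - L (y - v (j + 1)) 1 - L (y - v (j + 1)) 2 -
      max 0 (-L (y - v (j + 1)) 0) / κ, by fun_prop, ?_, ?_, ?_, ?_⟩
  · intro x hx hpos
    conv_rhs => rw [← hdecode x hx hpos]
    simp [rimDecode, add_one_ne hn, (add_one_ne hn _).symm]
  · rintro x ⟨hx, hx'⟩ y ⟨hy, hy'⟩ h
    rw [← hdecode x hx hx', h, hdecode y hy hy']
  · intro x hx hpos hb
    have h1 := mid_eq_zero_of_mem_boundary hn hb (j + 1)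
    have h2 := mid_eq_zero_of_mem_boundary hn hb j
    rw [← hdecode x hx hpos] at h1 h2
    have e1 : L (realize (spaceVertex v A B ζ) x - v (j + 1)) 1 = 0 := by
      simpa [rimDecode, add_one_ne hn, (add_one_ne hn _).symm] using h1
    have e2 : L (realize (spaceVertex v A B ζ) x - v (j + 1)) 2 = 0 := by
      simpa [rimDecode, add_one_ne hn, (add_one_ne hn _).symm] using h2
    change L (realize (spaceVertex v A B ζ) x - v (j + 1)) 1 +
      L (realize (spaceVertex v A B ζ) x - v (j + 1)) 2 = 0
    rw [e1, e2, add_zero]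
  · intro y hy
    beta_reduce at hy
    have hΦ : ∀ z : EuclideanSpace ℝ (Fin 4), halfHomeomorph (μ / κ) z = !₂[z 1 + z 2,
        z 0 + z 1 - z 2, z 2 - max 0 (min (z 1 + z 2) (((z 1 + z 2) - (z 0 + z 1 - z 2)) / 2)),
        z 3 - μ / κ * max 0 (-z 0)] := fun z => rfl
    simp only [Homeomorph.trans_apply, hΦ]
    change _ ↔ L (y - v (j + 1)) 2 - max 0 (min (L (y - v (j + 1)) 1 + L (y - v (j + 1)) 2)
        ((L (y - v (j + 1)) 1 + L (y - v (j + 1)) 2 - (L (y - v (j + 1)) 0 + L (y - v (j + 1)) 1 -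
          L (y - v (j + 1)) 2)) / 2)) = 0 ∧
      L (y - v (j + 1)) 3 - μ / κ * max 0 (-L (y - v (j + 1)) 0) = 0 ∧
      0 ≤ L (y - v (j + 1)) 1 + L (y - v (j + 1)) 2
    constructor
    · rintro ⟨x, ⟨hx, hpos⟩, rfl⟩
      rcases rim_star hn j hx hpos with ⟨β, β', ω, hs, rfl⟩ | ⟨β, β', ω, ω', hs, rfl⟩
      · obtain ⟨p1, p2, p3, p4, p5, ps, pa, pb, pc⟩ := hs
        rw [hcoord₁ _ _ _ ps]
        change 0 - max 0 (min (ω + 0) ((ω + 0 - (β' + ω - 0)) / 2)) = 0 ∧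
          0 - μ / κ * max 0 (-β') = 0 ∧ 0 ≤ ω + 0
        rw [max_eq_left ((min_le_right _ _).trans (by linarith)), max_eq_left (by linarith)]
        simpa using p3
      · obtain ⟨p1, p2, p3, p4, p5, ps, pa, pb, pc⟩ := hs
        rw [hcoord₂ _ _ _ _ ps]
        change ω - max 0 (min (ω' + ω) ((ω' + ω - (-(κ * β) + ω' - ω)) / 2)) = 0 ∧
          μ * β - μ / κ * max 0 (- -(κ * β)) = 0 ∧ 0 ≤ ω' + ω
        have hκβ : 0 ≤ κ * β := mul_nonneg hκ.le p1
        have hmin : min (ω' + ω) ((ω' + ω - (-(κ * β) + ω' - ω)) / 2) = ω := by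
          rcases mul_eq_zero.1 pc with rfl | rfl
          · rw [min_eq_right (by linarith)]; ring
          · rw [min_eq_left (by linarith), zero_add]
        rw [hmin, max_eq_right p3, neg_neg, max_eq_right hκβ]
        refine ⟨sub_self _, ?_, by linarith⟩
        field_simp
        ring
    · rintro ⟨h2, h3, h0⟩
      have finish₁ : 0 ≤ L (y - v (j + 1)) 0 → L (y - v (j + 1)) 2 = 0 →
          L (y - v (j + 1)) 3 = 0 → y ∈ realize (spaceVertex v A B ζ) ''
            {x | x ∈ realization (wheel n) ∧ 0 < x (rim (j + 1))} := by
        intro q0 q2 q3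
        rw [max_eq_right q0, max_eq_left (by linarith), zero_div, q2] at hy
        rw [q2, add_zero] at h0
        have hsec : IsSector (1 - L (y - v (j + 1)) 0 - L (y - v (j + 1)) 1)
            (L (y - v (j + 1)) 0) (L (y - v (j + 1)) 1) 0 0 :=
          ⟨by linarith, q0, h0, le_rfl, le_rfl, by ring, by simp, by simp, by simp⟩
        refine ⟨_, ⟨hsec.mem_realization (i := j + 1), ?_⟩, ?_⟩
        · rw [sectorPoint_rim hn]; linarith
        · have := hcoord₁ _ _ _ hsec.sum_eq
          rw [← sub_left_inj (a := v (j + 1))]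
          apply L.injective
          rw [this]
          ext k
          fin_cases k <;> simp [-map_sub, q2, q3]
      have finish₂ : L (y - v (j + 1)) 0 ≤ 0 → 0 ≤ L (y - v (j + 1)) 1 →
          0 ≤ L (y - v (j + 1)) 2 → L (y - v (j + 1)) 0 * L (y - v (j + 1)) 1 = 0 →
          y ∈ realize (spaceVertex v A B ζ) ''
            {x | x ∈ realization (wheel n) ∧ 0 < x (rim (j + 1))} := by
        intro q0 q1 q2 q01
        rw [max_eq_left q0, max_eq_right (by linarith)] at hy
        rw [max_eq_right (by linarith)] at h3
        have hsec : IsSector (-L (y - v (j + 1)) 0 / κ) (1 - L (y - v (j + 1)) 1 -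
            L (y - v (j + 1)) 2 - -L (y - v (j + 1)) 0 / κ) (L (y - v (j + 1)) 2)
            (L (y - v (j + 1)) 1) 0 := by
          refine ⟨div_nonneg (by linarith) hκ.le, by linarith, q2, q1, le_rfl, by ring, by simp,
            by simp, ?_⟩
          rw [div_mul_eq_mul_div, neg_mul, q01, neg_zero, zero_div]
        refine ⟨_, ⟨hsec.mem_realization (i := j), ?_⟩, ?_⟩
        · rw [sectorPoint_rim_succ hn]; linarith
        · have := hcoord₂ _ _ _ _ hsec.sum_eq
          rw [← sub_left_inj (a := v (j + 1))]
          apply L.injective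
          rw [this]
          ext k
          fin_cases k
          · simp [-map_sub]; field_simp
          · simp
          · simp
          · simp only [Fin.reduceFinMk, Matrix.cons_val]
            linear_combination -h3
      obtain ⟨q2, hpos, hneg⟩ := clamp_cases h2 h0
      rcases le_or_gt (L (y - v (j + 1)) 0) 0 with hle | hgt
      · exact finish₂ hle (hneg hle).1 q2 (hneg hle).2
      · refine finish₁ hgt.le (hpos hgt) ?_
        rwa [max_eq_left (by linarith), mul_zero, sub_zero] at h3

/-- The star is planar, so an affine chart suffices. The largest gauge N equals the total inner
weight on the star and is continuous everywhere, which gives ρ = 1 − N. -/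
theorem IsGeneric.exists_chart_hub (hn : 3 ≤ n) (hg : IsGeneric v A B ζ)
    (hv : ∀ i, v (i + 1) ≠ v i) :
    ∃ (Φ : EuclideanSpace ℝ (Fin 4) ≃ₜ EuclideanSpace ℝ (Fin 4))
      (ρ : EuclideanSpace ℝ (Fin 4) → ℝ), Continuous ρ ∧
      (∀ x ∈ realization (wheel n), 0 < x hub →
        ρ (realize (spaceVertex v A B ζ) x) = x hub) ∧
      Set.InjOn (realize (spaceVertex v A B ζ))
        {x | x ∈ realization (wheel n) ∧ 0 < x hub} ∧
      ∀ y, 0 < ρ y → (y ∈ realize (spaceVertex v A B ζ) ''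
        {x | x ∈ realization (wheel n) ∧ 0 < x hub} ↔ Φ y 2 = 0 ∧ Φ y 3 = 0) := by
  obtain ⟨L, hL⟩ := exists_coordinates (a := A) (b := B) (c := v (0 + 1) - v 0) (d := ζ - v 0) (by
    intro r s t u h
    obtain rfl : u = 0 := eq_zero_of_notMem_span (hg.hub_notMem 0) (s := r) (t := s) (u := t) (by
      rw [← h]; abel)
    obtain ⟨rfl, rfl⟩ := hg.plane 0 r s t 0 (by rw [← h]; module)
    exact ⟨rfl, rfl, (smul_eq_zero.1 (show t • (v (0 + 1) - v 0) = 0 by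
      rw [← h]; module)).resolve_right (sub_ne_zero.2 (hv 0)), rfl⟩)
  have hcoord : ∀ (i : Fin n) (ω ω' γ : ℝ), 0 + 0 + ω + ω' + γ = 1 →
      L (realize (spaceVertex v A B ζ) (sectorPoint i 0 0 ω ω' γ) - ζ) =
        !₂[ω * ngonX i + ω' * ngonX (i + 1), ω * ngonY i + ω' * ngonY (i + 1), 0, 0] := by
    intro i ω ω' γ hs
    rw [← hL, realize_spaceVertex]
    congr 1
    obtain rfl : γ = 1 - ω - ω' := by linarith
    simp only [innerVertex]
    module
  let N : ℝ → ℝ → ℝ := fun x y => Finset.univ.sup' ⟨(0 : Fin n), Finset.mem_univ _⟩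
    fun k => gauge k x y
  have hN : ∀ (i : Fin n) (s t : ℝ), 0 ≤ s → 0 ≤ t →
      N (s * ngonX i + t * ngonX (i + 1)) (s * ngonY i + t * ngonY (i + 1)) = s + t := by
    intro i s t hs ht
    apply le_antisymm
    · exact Finset.sup'_le _ _ fun k _ => gauge_sector_le hn i k hs ht
    · rw [← gauge_sector hn i s t]
      exact Finset.le_sup' (fun k => gauge k _ _) (Finset.mem_univ i)
  refine ⟨(Homeomorph.subRight ζ).trans L.toHomeomorph,
    fun y => 1 - N (L (y - ζ) 0) (L (y - ζ) 1), ?_, ?_, ?_, ?_⟩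
  · refine continuous_const.sub ?_
    refine Continuous.finset_sup'_apply _ fun k _ => ?_
    unfold gauge; fun_prop
  · intro x hx hpos
    obtain ⟨i, ω, ω', γ, hs, rfl⟩ := hub_star hn hx hpos
    have hsum := hs.sum_eq
    rw [sectorPoint_hub]
    beta_reduce
    rw [hcoord _ _ _ _ hsum]
    change 1 - N (ω * ngonX i + ω' * ngonX (i + 1)) (ω * ngonY i + ω' * ngonY (i + 1)) = γ
    rw [hN _ _ _ hs.nonneg₃ hs.nonneg₄]
    linarith
  · rintro x ⟨hx, hx'⟩ y ⟨hy, hy'⟩ h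
    -- The A, B coordinates coincide with the planar model on this star, so injectivity is inherited
    -- from it.
    apply injOn_realize_planeVertex hn hx hy
    obtain ⟨i, ω, ω', γ, hs, rfl⟩ := hub_star hn hx hx'
    obtain ⟨k, w, w', c, hs', rfl⟩ := hub_star hn hy hy'
    have e1 := hcoord i ω ω' γ hs.sum_eq
    have e2 := hcoord k w w' c hs'.sum_eq
    rw [h, e2] at e1
    have h0 := congrArg (fun z => z 0) e1
    have h1 := congrArg (fun z => z 1) e1
    simp only [Matrix.cons_val_zero, Matrix.cons_val_one] at h0 h1
    rw [realize_planeVertex, realize_planeVertex]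
    simp only [mul_zero, zero_add, h0, h1]
  · intro y hy
    beta_reduce at hy
    change _ ↔ L (y - ζ) 2 = 0 ∧ L (y - ζ) 3 = 0
    constructor
    · rintro ⟨x, ⟨hx, hpos⟩, rfl⟩
      obtain ⟨i, ω, ω', γ, hs, rfl⟩ := hub_star hn hx hpos
      rw [hcoord _ _ _ _ hs.sum_eq]
      exact ⟨rfl, rfl⟩
    · rintro ⟨h2, h3⟩
      obtain ⟨i, s, t, hs, ht, hX, hY⟩ := exists_sector hn (L (y - ζ) 0) (L (y - ζ) 1)
      rw [hX, hY, hN _ _ _ hs ht] at hy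
      have hsec : IsSector 0 0 s t (1 - (s + t)) :=
        ⟨le_rfl, le_rfl, hs, ht, hy.le, by ring, by simp, by simp, by simp⟩
      refine ⟨_, ⟨hsec.mem_realization (i := i), ?_⟩, ?_⟩
      · rwa [sectorPoint_hub]
      · rw [← sub_left_inj (a := ζ)]
        apply L.injective
        rw [hcoord _ _ _ _ hsec.sum_eq]
        ext k
        fin_cases k <;> simp [-map_sub, hX, hY, h2, h3]

end RimAndHub

/-! ### Assembling the spanning disk -/

section Spanning

variable {n : ℕ} [NeZero n]

theorem IsEmbeddedPolygon.succ_ne (hn : 3 ≤ n) {P : Polygon (EuclideanSpace ℝ (Fin 4)) n}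
    (hP : IsEmbeddedPolygon P) (i : Fin n) : P (i + 1) ≠ P i := fun h =>
  add_one_ne hn i (hP.edge_eq (s := 0) (t := 0) (by simp) (by simp) (by simp [h])).1

/-- Dependent edges point from their common vertex in opposite directions or in the same one; in the
latter case they would overlap. -/
theorem IsEmbeddedPolygon.consecutive_edges (hn : 3 ≤ n)
    {P : Polygon (EuclideanSpace ℝ (Fin 4)) n} (hP : IsEmbeddedPolygon P) (j : Fin n) :
    (∀ r s : ℝ, r • (P (j + 1 + 1) - P (j + 1)) + s • (P j - P (j + 1)) = 0 → r = 0 ∧ s = 0) ∨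
      ∃ κ : ℝ, 0 < κ ∧ P j - P (j + 1) = -κ • (P (j + 1 + 1) - P (j + 1)) := by
  by_cases h : ∀ r s : ℝ, r • (P (j + 1 + 1) - P (j + 1)) + s • (P j - P (j + 1)) = 0 →
    r = 0 ∧ s = 0
  · exact .inl h
  right
  have ha : P (j + 1 + 1) - P (j + 1) ≠ 0 := sub_ne_zero.2 (hP.succ_ne hn _)
  have hd : P j - P (j + 1) ≠ 0 := sub_ne_zero.2 (hP.succ_ne hn _).symm
  push Not at h
  obtain ⟨r, s, h0, hrs⟩ := h
  have hs : s ≠ 0 := by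
    rintro rfl
    rw [zero_smul, add_zero] at h0
    exact hrs ((smul_eq_zero.1 h0).resolve_right ha) rfl
  have hdκ : P j - P (j + 1) = -(r / s) • (P (j + 1 + 1) - P (j + 1)) := by
    rw [neg_smul, div_eq_inv_mul, mul_smul, eq_neg_of_add_eq_zero_left h0, smul_neg, neg_neg,
      smul_smul, inv_mul_cancel₀ hs, one_smul]
  refine ⟨r / s, ?_, hdκ⟩
  generalize r / s = κ at hdκ
  by_contra hκ
  have hκ0 : κ ≠ 0 := by
    rintro rfl
    exact hd (by rw [hdκ, neg_zero, zero_smul])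
  have hneg : κ < 0 := lt_of_le_of_ne (not_lt.1 hκ) hκ0
  have hpos : 0 < 2 * (1 - κ) := by linarith
  have h1 : -κ / (2 * (1 - κ)) < 1 := by rw [div_lt_one hpos]; linarith
  have h2 : 1 / (2 * (1 - κ)) ≤ 1 := by rw [div_le_one hpos]; linarith
  have h3 : 0 < 1 / (2 * (1 - κ)) := by positivity
  -- For κ < 0 the edges meet at the fraction −κ / (2(1 − κ)) along edge j + 1 and 1 / (2(1 − κ))
  -- back along edge j; the factor 2 keeps both below 1/2.
  refine add_one_ne hn j (hP.edge_eq (i := j + 1) (j := j) (s := -κ / (2 * (1 - κ)))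
    (t := 1 - 1 / (2 * (1 - κ))) ⟨div_nonneg (by linarith) hpos.le, h1⟩
    ⟨by linarith, by linarith⟩ ?_).1
  have e : P (j + 1) + (1 / (2 * (1 - κ))) • (-κ • (P (j + 1 + 1) - P (j + 1))) =
      P (j + 1) + (1 / (2 * (1 - κ))) • (P j - P (j + 1)) := by rw [hdκ]
  rw [← sub_eq_zero] at e ⊢
  rw [← e]
  module

/-- A point without inner or hub weight lies on the rim, so rim charts, which show a half-plane, are
used only at boundary points. -/
theorem exists_pos_mid_or_hub_or_mem_boundary (hn : 3 ≤ n) {x : Vert n → ℝ}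
    (hx : x ∈ realization (wheel n)) : (∃ j, 0 < x (mid (j + 1))) ∨ 0 < x hub ∨
      (x ∈ boundary (wheel n) ∧ ∃ j, 0 < x (rim (j + 1))) := by
  by_cases h1 : ∃ j, 0 < x (mid (j + 1))
  · exact .inl h1
  by_cases h2 : 0 < x hub
  · exact .inr (.inl h2)
  have hmid : ∀ i : Fin n, x (mid i) = 0 := fun i =>
    le_antisymm (not_lt.1 fun h => h1 ⟨i - 1, by rwa [sub_add_cancel]⟩) (hx.1.1 _)
  obtain ⟨i, β, β', ω, ω', γ, hs, rfl⟩ := exists_isSector hn hx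
  have e1 := hmid i
  have e2 := hmid (i + 1)
  rw [sectorPoint_mid hn] at e1
  rw [sectorPoint_mid_succ hn] at e2
  rw [sectorPoint_hub] at h2
  subst e1 e2
  obtain rfl : γ = 0 := le_antisymm (not_lt.1 h2) hs.nonneg₅
  have hsum := hs.sum_eq
  refine .inr (.inr ⟨sectorPoint_mem_boundary hn hs.nonneg₁ hs.nonneg₂ (by linarith), ?_⟩)
  by_cases h : 0 < β'
  · exact ⟨i, by rwa [sectorPoint_rim_succ hn]⟩
  · exact ⟨i - 1, by rw [sub_add_cancel, sectorPoint_rim hn]; linarith⟩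

theorem IsGeneric.isLocallyFlat (hn : 3 ≤ n) {P : Polygon (EuclideanSpace ℝ (Fin 4)) n}
    (hP : IsEmbeddedPolygon P) {A B ζ : EuclideanSpace ℝ (Fin 4)} (hg : IsGeneric P A B ζ) :
    IsLocallyFlat (wheel n) (spaceVertex P A B ζ) := by
  intro x hx
  rcases exists_pos_mid_or_hub_or_mem_boundary hn hx with ⟨j, hpos⟩ | hpos | ⟨hb, j, hpos⟩
  · obtain ⟨Φ, ρ, hρ, hρw, hinj, hΦ⟩ := hg.exists_chart_mid hn (hP.succ_ne hn) j
    obtain ⟨U, hU, hxU, hemb, e, hxe, he, hstar⟩ :=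
      exists_chart_of_star _ _ _ hinj Φ hρ hρw hx hpos
    refine ⟨U, hU, hxU, hemb, e, hxe, fun _ y hy => ?_, fun hb => ?_⟩
    · rw [(hstar y hy).2, he]
      exact hΦ y (hstar y hy).1
    · exact absurd (mid_eq_zero_of_mem_boundary hn hb _) hpos.ne'
  · obtain ⟨Φ, ρ, hρ, hρw, hinj, hΦ⟩ := hg.exists_chart_hub hn (hP.succ_ne hn)
    obtain ⟨U, hU, hxU, hemb, e, hxe, he, hstar⟩ :=
      exists_chart_of_star _ _ _ hinj Φ hρ hρw hx hpos
    refine ⟨U, hU, hxU, hemb, e, hxe, fun _ y hy => ?_, fun hb => ?_⟩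
    · rw [(hstar y hy).2, he]
      exact hΦ y (hstar y hy).1
    · exact absurd (hub_eq_zero_of_mem_boundary hn hb) hpos.ne'
  · obtain ⟨Φ, ρ, hρ, hρw, hinj, hΦb, hΦ⟩ := hg.exists_chart_rim hn j
      (sub_ne_zero.2 (hP.succ_ne hn _)) (hP.consecutive_edges hn j)
    obtain ⟨U, hU, hxU, hemb, e, hxe, he, hstar⟩ :=
      exists_chart_of_star _ _ _ hinj Φ hρ hρw hx hpos
    refine ⟨U, hU, hxU, hemb, e, hxe, fun h => absurd hb h, fun _ => ⟨?_, fun y hy => ?_⟩⟩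
    · rw [he]
      exact hΦb x hx hpos hb
    · rw [(hstar y hy).2, he]
      exact hΦ y (hstar y hy).1

theorem IsLocallyFlat.isImmersed {V : Type*} [Fintype V] {K : AbstractSimplicialComplex V}
    {p : V → EuclideanSpace ℝ (Fin 4)} (h : IsLocallyFlat K p) : IsImmersed K p := by
  intro x hx
  obtain ⟨U, hU, hxU, hemb, -⟩ := h x hx
  refine ⟨U, hU, hxU, fun y hy z hz hyz => ?_⟩
  exact congrArg Subtype.val (@hemb.injective ⟨y, hy⟩ ⟨z, hz⟩ hyz)

theorem hasPLBoundary_wheel (hn : 3 ≤ n) (P : Polygon (EuclideanSpace ℝ (Fin 4)) n)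
    (A B ζ : EuclideanSpace ℝ (Fin 4)) :
    HasPLBoundary (wheel n) (spaceVertex P A B ζ) P := by
  refine ⟨rim, Sum.inl_injective, fun e => ?_, fun i => rfl⟩
  rw [mem_boundaryEdges_wheel hn]
  refine exists_congr fun i => ?_
  rw [finRotate_apply, ← Finset.coe_inj, Finset.coe_pair]

end Spanning

end PLSurface

theorem theorem1p4 (n : ℕ) (hn : 3 ≤ n) (P : Polygon (EuclideanSpace ℝ (Fin 4)) n)
    (hP : PLSurface.IsEmbeddedPolygon P) :
    ∃ (V : Type) (_ : Fintype V) (K : AbstractSimplicialComplex V)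
      (p : V → EuclideanSpace ℝ (Fin 4)),
      PLSurface.IsPLDisk K ∧
      PLSurface.IsComplementaryImmersed K p ∧
      PLSurface.IsLocallyFlat K p ∧
      PLSurface.HasPLBoundary K p P ∧
      (PLSurface.triangles K).ncard = 3 * n := by
  have : NeZero n := ⟨by omega⟩
  obtain ⟨A, B, ζ, hg⟩ := PLSurface.exists_isGeneric P.vertices
  have hflat := PLSurface.IsGeneric.isLocallyFlat hn hP hg
  refine ⟨PLSurface.Vert n, inferInstance, PLSurface.wheel n, PLSurface.spaceVertex P A B ζ,
    PLSurface.isPLDisk_wheel hn, ⟨hflat.isImmersed, PLSurface.injOn_boundary hn P hP, ?_⟩, hflat,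
    PLSurface.hasPLBoundary_wheel hn P A B ζ, PLSurface.ncard_triangles_wheel hn⟩
  rw [Set.disjoint_left]
  rintro _ ⟨x, ⟨hx, hxb⟩, rfl⟩ ⟨y, hy, hxy⟩
  exact hxb (hg.mem_boundary hn hx hy hxy.symm)
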